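/- Let $\mathsf{Grid}$ be the infinite grid graph with vertex set $\mathbb{Z}\times\mathbb{Z}$, in which $u$ and $v$ are adjacent if and only if $\|u-v\|_1=1$. For an edge-weight assignment $W:E(\mathsf{Grid})\to\mathbb{R}_{\ge 0}$, let $\operatorname{dist}_W(u,v)$ be the infimum, over all walks in $\mathsf{Grid}$ from $u$ to $v$, of the sum of the weights of the edges of the walk. Then there exist an assignment $W:E(\mathsf{Grid})\to\mathbb{R}_{\ge 0}$ and a constant $C$ such that for all $u,v\in\mathbb{Z}\times\mathbb{Z}$, \[ \|u-v\|_2-1\;\le\;\operatorname{dist}_W(u,v)\;\le\;\|u-v\|_2+C\,\|u-v\|_2^{8/9}. \] -/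

import Mathlib

open scoped NNReal

/-- The infinite grid graph on `ℤ × ℤ`: two grid points are adjacent iff their
`ℓ¹`-distance is `1`. -/
def Grid : SimpleGraph (ℤ × ℤ) where
  Adj u v := |u.1 - v.1| + |u.2 - v.2| = 1
  symm := ⟨fun u v h => by
    rw [abs_sub_comm v.1, abs_sub_comm v.2]
    exact h⟩
  loopless := ⟨fun u h => by simp at h⟩

/-- The total weight of a walk in the grid: the sum of the weights of its edges, counted
with multiplicity. -/
def walkWeight (W : Grid.edgeSet → ℝ≥0) : {u v : ℤ × ℤ} → Grid.Walk u v → ℝ≥0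
  | _, _, .nil => 0
  | _, _, .cons (u := a) (v := b) h p => W ⟨s(a, b), Grid.mem_edgeSet.2 h⟩ + walkWeight W p

/-- The weighted distance in the grid with edge weights `W`: the infimum of the weights of
all walks from `u` to `v`. -/
noncomputable def gridDist (W : Grid.edgeSet → ℝ≥0) (u v : ℤ × ℤ) : ℝ :=
  ⨅ p : Grid.Walk u v, (walkWeight W p : ℝ)

/-- The grid point `u` as a point of the Euclidean plane. -/
noncomputable def toPlane (u : ℤ × ℤ) : EuclideanSpace ℝ (Fin 2) :=
  !₂[(u.1 : ℝ), (u.2 : ℝ)]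

/-- The grid is connected, so the infimum in `gridDist` is over a nonempty set. -/
theorem grid_preconnected : Grid.Preconnected := by
  have hx : ∀ (n : ℕ) (a b : ℤ), Grid.Reachable (a, b) (a + n, b) := by
    intro n a b
    induction n with
    | zero => simp
    | succ k ih =>
      refine ih.trans (SimpleGraph.Adj.reachable ?_)
      simp [Grid, ← add_assoc]
  have hy : ∀ (n : ℕ) (a b : ℤ), Grid.Reachable (a, b) (a, b + n) := by
    intro n a b
    induction n with
    | zero => simp
    | succ k ih =>
      refine ih.trans (SimpleGraph.Adj.reachable ?_)
      simp [Grid, ← add_assoc]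
  have hx' : ∀ a a' b : ℤ, Grid.Reachable (a, b) (a', b) := by
    intro a a' b
    rcases le_total a a' with h | h
    · obtain ⟨n, rfl⟩ := Int.le.dest h
      exact hx n a b
    · obtain ⟨n, rfl⟩ := Int.le.dest h
      exact (hx n a' b).symm
  have hy' : ∀ a b b' : ℤ, Grid.Reachable (a, b) (a, b') := by
    intro a b b'
    rcases le_total b b' with h | h
    · obtain ⟨n, rfl⟩ := Int.le.dest h
      exact hy n a b
    · obtain ⟨n, rfl⟩ := Int.le.dest h
      exact (hy n a b').symm
  rintro ⟨a, b⟩ ⟨a', b'⟩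
  exact (hx' a a' b).trans (hy' a' b b')

/-!
The weights are edge lengths of a redrawing of the grid. In the plane there are *highways*: for
every level `n`, lines with `2 ^ (-n)`-dense directions and spacing about `2 ^ (16 n)`. A line is
digitized to a monotone grid path (`GridLine.Mem`), and each grid point is given to at most one
line through it (`owner`). An owned point is drawn at its orthogonal projection to its line, all
others at their own place (`position`); an edge weighs its drawn length, plus a surcharge of one
unless both its ends are owned by the same line (`weight`).

*Lower bound.* Points move by at most `3 / 4`, so a walk that pays the surcharge is long enough by
the triangle inequality. A walk that does not pay it stays on one digital line, where projecting
shortens distances by at most one (`GridLine.Mem.norm_sub_le`).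

*Upper bound.* Let the distance `d` be between `2 ^ (18 n)` and `2 ^ (18 n + 18)`. Two legs in
adjacent directions of level `n` lose only `d / 4 ^ n`, of order `2 ^ (16 n) ≤ d ^ (8 / 9)`
(`exists_two_legs`), and reaching lines of level `n` costs `O(2 ^ (16 n))`. Following a line costs
its Euclidean length plus a constant for each point lost to another line
(`GridLine.walkWithin_along`), so it remains to bound the number of lost points.

*Ownership.* Lines of all higher levels may pass through the region at hand, without any bound on
their number or on the angles. Therefore ownership is decided from the top down along a nested
family of cells: a cell of level `i`, of side `2 ^ (6 i)`, has a single owner, inherited from its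
parent if that owner meets the cell and otherwise chosen among the lines of level `i`. A line of
level `n` then loses points only near the origin, near lines of levels from `n` to `3 n + 3`, and
near owners of cells of level `3 n + 4` (`owner_ne`). The lines of the second kind have bounded
heights, so they are few and transversal to the given line, and the loss is `O(2 ^ (16 n))`
(`card_near_comparable_le`). The cells of level `3 n + 4` are larger than the region, so there are
at most four lines of the third kind; one of five neighbouring parallels is not nearly parallel and
close to any of them (`exists_unobstructed`).
-/

/-! ### Walks of bounded weight -/

theorem walkWeight_append (W : Grid.edgeSet → ℝ≥0) {u v w : ℤ × ℤ} (p : Grid.Walk u v)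
    (p' : Grid.Walk v w) :
    walkWeight W (p.append p') = walkWeight W p + walkWeight W p' := by
  induction p with
  | nil => simp [walkWeight]
  | cons h p ih => simp [walkWeight, ih, add_assoc]

theorem walkWeight_reverse (W : Grid.edgeSet → ℝ≥0) {u v : ℤ × ℤ} (p : Grid.Walk u v) :
    walkWeight W p.reverse = walkWeight W p := by
  induction p with
  | nil => simp [walkWeight]
  | @cons a b c h p ih =>
    have e : (⟨s(b, a), Grid.mem_edgeSet.2 h.symm⟩ : Grid.edgeSet)
        = ⟨s(a, b), Grid.mem_edgeSet.2 h⟩ := Subtype.ext Sym2.eq_swap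
    simp [walkWeight, walkWeight_append, ih, e, add_comm]

/-- Some walk from `u` to `v` has weight at most `L`. -/
def WalkWithin (W : Grid.edgeSet → ℝ≥0) (u v : ℤ × ℤ) (L : ℝ) : Prop :=
  ∃ p : Grid.Walk u v, (walkWeight W p : ℝ) ≤ L

namespace WalkWithin

variable {W : Grid.edgeSet → ℝ≥0} {u v w : ℤ × ℤ} {K L : ℝ}

theorem refl (u : ℤ × ℤ) : WalkWithin W u u 0 := ⟨.nil, by simp [walkWeight]⟩

theorem trans (h : WalkWithin W u v K) (h' : WalkWithin W v w L) : WalkWithin W u w (K + L) := by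
  obtain ⟨p, hp⟩ := h
  obtain ⟨p', hp'⟩ := h'
  refine ⟨p.append p', ?_⟩
  rw [walkWeight_append]
  push_cast
  exact add_le_add hp hp'

theorem symm (h : WalkWithin W u v L) : WalkWithin W v u L := by
  obtain ⟨p, hp⟩ := h
  exact ⟨p.reverse, by rwa [walkWeight_reverse]⟩

theorem mono (h : WalkWithin W u v K) (hKL : K ≤ L) : WalkWithin W u v L := by
  obtain ⟨p, hp⟩ := h
  exact ⟨p, hp.trans hKL⟩

theorem of_adj (h : Grid.Adj u v) : WalkWithin W u v (W ⟨s(u, v), Grid.mem_edgeSet.2 h⟩) :=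
  ⟨.cons h .nil, by simp [walkWeight]⟩

theorem gridDist_le (h : WalkWithin W u v L) : gridDist W u v ≤ L := by
  obtain ⟨p, hp⟩ := h
  exact (ciInf_le ⟨0, by rintro _ ⟨p, rfl⟩; exact NNReal.coe_nonneg _⟩ p).trans hp

/-- If no edge weighs more than `B`, any two grid points are joined by a walk of weight at most
`B` times their `ℓ¹`-distance. -/
theorem of_edge_le {B : ℝ} (hB : ∀ e, (W e : ℝ) ≤ B) (u v : ℤ × ℤ) :
    WalkWithin W u v (B * (|u.1 - v.1| + |u.2 - v.2| : ℤ)) := by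
  obtain ⟨n, hn⟩ : ∃ n : ℕ, (n : ℤ) = |u.1 - v.1| + |u.2 - v.2| :=
    ⟨(|u.1 - v.1| + |u.2 - v.2|).toNat, Int.toNat_of_nonneg (by positivity)⟩
  rw [← hn]
  induction n generalizing u with
  | zero =>
    have : u = v := by
      have h1 := abs_nonneg (u.1 - v.1)
      have h2 := abs_nonneg (u.2 - v.2)
      have h3 : |u.1 - v.1| = 0 := by push_cast at hn; omega
      have h4 : |u.2 - v.2| = 0 := by push_cast at hn; omega
      exact Prod.ext (sub_eq_zero.1 (abs_eq_zero.1 h3)) (sub_eq_zero.1 (abs_eq_zero.1 h4))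
    subst this
    simpa using refl u
  | succ n ih =>
    obtain ⟨w, huw, hw⟩ : ∃ w : ℤ × ℤ, Grid.Adj u w ∧
        (n : ℤ) = |w.1 - v.1| + |w.2 - v.2| := by
      obtain ⟨x, y⟩ := u
      obtain ⟨x', y'⟩ := v
      simp only [Grid] at *
      push_cast at hn
      rcases lt_trichotomy x x' with h | h | h
      · exact ⟨(x + 1, y), by simp, by simp only; grind⟩
      · rcases lt_trichotomy y y' with h' | h' | h'
        · exact ⟨(x, y + 1), by simp, by simp only; grind⟩
        · subst h h'
          simp at hn
          omega
        · exact ⟨(x, y - 1), by simp, by simp only; grind⟩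
      · exact ⟨(x - 1, y), by simp, by simp only; grind⟩
    refine ((of_adj huw).trans (ih w hw)).mono ?_
    have := hB ⟨s(u, w), Grid.mem_edgeSet.2 huw⟩
    push_cast
    linarith

/-- Concatenation of the edges of a sequence of consecutively adjacent grid points. -/
theorem of_seq (γ : ℕ → ℤ × ℤ) (c : ℕ → ℝ) (K : ℕ)
    (h : ∀ k < K, WalkWithin W (γ k) (γ (k + 1)) (c k)) :
    WalkWithin W (γ 0) (γ K) (∑ k ∈ Finset.range K, c k) := by
  induction K with
  | zero => simpa using refl (γ 0)
  | succ K ih =>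
    rw [Finset.sum_range_succ]
    exact (ih fun k hk => h k (by omega)).trans (h K (by omega))

end WalkWithin

/-! ### Digital lines -/

theorem toPlane_sub_norm (u v : ℤ × ℤ) :
    ‖toPlane u - toPlane v‖ = √(((u.1 - v.1 : ℤ) : ℝ) ^ 2 + ((u.2 - v.2 : ℤ) : ℝ) ^ 2) := by
  simp [toPlane, EuclideanSpace.norm_eq, Fin.sum_univ_two]

/-- The line `q x - p y = c` in the plane, given by its integral direction `(p, q)` and its
level `c`. -/
@[ext] structure GridLine where
  /-- first coordinate of the direction -/
  p : ℤ
  /-- second coordinate of the direction -/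
  q : ℤ
  /-- value of `q x - p y` on the line -/
  c : ℤ

namespace GridLine

variable {ℓ ℓ' : GridLine} {u v w : ℤ × ℤ}

/-- The sup-norm of the direction. -/
def height (ℓ : GridLine) : ℤ := max |ℓ.p| |ℓ.q|

/-- The signed, unnormalized distance of a grid point from the line. -/
def val (ℓ : GridLine) (v : ℤ × ℤ) : ℤ := ℓ.q * v.1 - ℓ.p * v.2 - ℓ.c

/-- The standard digitization of the line: the grid points in a half-open strip around it whose
width is just large enough to make them the vertices of a monotone grid path. -/
def Mem (ℓ : GridLine) (v : ℤ × ℤ) : Prop :=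
  -(|ℓ.p| + |ℓ.q|) < 2 * ℓ.val v ∧ 2 * ℓ.val v ≤ |ℓ.p| + |ℓ.q|

/-- The direction is one of the two primitive integer vectors spanning its line; the sign is
chosen so that each rational direction is represented exactly once. -/
structure Normalized (ℓ : GridLine) : Prop where
  coprime : IsCoprime ℓ.p ℓ.q
  sign : 0 < ℓ.p ∨ (ℓ.p = 0 ∧ ℓ.q = 1)

/-- The determinant of the directions of two lines. -/
def det (ℓ ℓ' : GridLine) : ℤ := ℓ'.p * ℓ.q - ℓ.p * ℓ'.q

/-- The sign of the vertical component along the direction of the line (for `p ≥ 0`). -/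
def slopeSign (ℓ : GridLine) : ℤ := if 0 ≤ ℓ.q then 1 else -1

/-- The number of steps along the digital line, counted from an arbitrary origin. -/
def progress (ℓ : GridLine) (v : ℤ × ℤ) : ℤ := v.1 + ℓ.slopeSign * v.2

theorem Normalized.p_nonneg (h : ℓ.Normalized) : 0 ≤ ℓ.p := by
  rcases h.sign with h | h <;> omega

theorem Normalized.height_pos (h : ℓ.Normalized) : 0 < ℓ.height := by
  rcases h.sign with h | h
  · exact lt_max_of_lt_left (abs_pos.2 h.ne')
  · exact lt_max_of_lt_right (abs_pos.2 (by omega))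

theorem abs_p_le (ℓ : GridLine) : |ℓ.p| ≤ ℓ.height := le_max_left _ _

theorem abs_q_le (ℓ : GridLine) : |ℓ.q| ≤ ℓ.height := le_max_right _ _

theorem direction_ne_zero (h : 0 < ℓ.height) : ℓ.p ≠ 0 ∨ ℓ.q ≠ 0 := by
  by_contra! h'
  simp [height, h'.1, h'.2] at h

theorem Normalized.eq_of_det_eq_zero (h : ℓ.Normalized) (h' : ℓ'.Normalized)
    (hd : det ℓ ℓ' = 0) : ℓ'.p = ℓ.p ∧ ℓ'.q = ℓ.q := by
  have e : ℓ'.p * ℓ.q = ℓ.p * ℓ'.q := sub_eq_zero.1 hd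
  have h1 : ℓ.p ∣ ℓ'.p := h.coprime.dvd_of_dvd_mul_right (Dvd.intro _ e.symm)
  have h2 : ℓ'.p ∣ ℓ.p := h'.coprime.dvd_of_dvd_mul_right (Dvd.intro _ e)
  have hp : ℓ'.p = ℓ.p := Int.dvd_antisymm h'.p_nonneg h.p_nonneg h2 h1
  refine ⟨hp, ?_⟩
  rcases h.sign with hs | hs
  · rw [hp] at e
    exact (mul_left_cancel₀ hs.ne' e).symm
  · rcases h'.sign with hs' | hs' <;> omega

theorem abs_val_sub_lt (hu : ℓ.Mem u) (hv : ℓ.Mem v) :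
    |ℓ.q * (u.1 - v.1) - ℓ.p * (u.2 - v.2)| < |ℓ.p| + |ℓ.q| := by
  have e : ℓ.q * (u.1 - v.1) - ℓ.p * (u.2 - v.2) = ℓ.val u - ℓ.val v := by
    simp only [val]; ring
  rw [e, abs_lt]
  have := hu.1; have := hu.2; have := hv.1; have := hv.2
  constructor <;> linarith

/-- A digital line is a monotone path: along it both coordinates move in the direction of the
line. -/
theorem Mem.monotone (hp : 0 ≤ ℓ.p) (hu : ℓ.Mem u) (hv : ℓ.Mem v)
    (h : ℓ.progress u ≤ ℓ.progress v) :
    u.1 ≤ v.1 ∧ ℓ.slopeSign * u.2 ≤ ℓ.slopeSign * v.2 := by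
  have key := abs_lt.1 (abs_val_sub_lt hv hu)
  obtain ⟨k1, k2⟩ := key
  rw [abs_of_nonneg hp] at k1 k2
  unfold progress at h
  unfold slopeSign at *
  split_ifs at h ⊢ with hq
  · rw [abs_of_nonneg hq] at k1 k2
    constructor
    · by_contra! hc
      nlinarith [mul_nonneg hp (by linarith : 0 ≤ v.2 - u.2 - 1),
        mul_nonneg hq (by linarith : 0 ≤ u.1 - v.1 - 1)]
    · by_contra! hc
      nlinarith [mul_nonneg hp (by linarith : 0 ≤ u.2 - v.2 - 1),
        mul_nonneg hq (by linarith : 0 ≤ v.1 - u.1 - 1)]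
  · push Not at hq
    rw [abs_of_neg hq] at k1 k2
    constructor
    · by_contra! hc
      nlinarith [mul_nonneg hp (by linarith : 0 ≤ u.2 - v.2 - 1),
        mul_nonneg (neg_nonneg.2 hq.le) (by linarith : 0 ≤ u.1 - v.1 - 1)]
    · by_contra! hc
      nlinarith [mul_nonneg hp (by linarith : 0 ≤ v.2 - u.2 - 1),
        mul_nonneg (neg_nonneg.2 hq.le) (by linarith : 0 ≤ v.1 - u.1 - 1)]

theorem slopeSign_eq (ℓ : GridLine) : ℓ.slopeSign = 1 ∨ ℓ.slopeSign = -1 := by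
  unfold slopeSign; split_ifs <;> simp

theorem Mem.eq_of_progress_eq (hp : 0 ≤ ℓ.p) (hu : ℓ.Mem u) (hv : ℓ.Mem v)
    (h : ℓ.progress u = ℓ.progress v) : u = v := by
  have h1 := hu.monotone hp hv h.le
  have h2 := hv.monotone hp hu h.ge
  rcases ℓ.slopeSign_eq with e | e <;> rw [e] at h1 h2 <;> ext <;> omega

/-- Every grid point of a digital line has a successor on it. -/
theorem Mem.exists_succ (hp : 0 ≤ ℓ.p) (hv : ℓ.Mem v) :
    ∃ w, Grid.Adj v w ∧ ℓ.Mem w ∧ ℓ.progress w = ℓ.progress v + 1 := by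
  obtain ⟨h1, h2⟩ := hv
  obtain ⟨x, y⟩ := v
  unfold val at h1 h2
  unfold Mem progress slopeSign val
  rw [abs_of_nonneg hp] at *
  simp only at *
  split_ifs with hq
  · rw [abs_of_nonneg hq] at *
    by_cases h : 2 * (ℓ.q * x - ℓ.p * y - ℓ.c) ≤ ℓ.p - ℓ.q
    · exact ⟨(x + 1, y), by simp [Grid], ⟨by simp only; linarith, by simp only; linarith⟩,
        by simp only; ring⟩
    · exact ⟨(x, y + 1), by simp [Grid], ⟨by simp only; linarith, by simp only; linarith⟩,
        by simp only; ring⟩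
  · rw [abs_of_neg (not_le.1 hq)] at *
    by_cases h : 2 * (ℓ.q * x - ℓ.p * y - ℓ.c) ≤ -ℓ.q - ℓ.p
    · exact ⟨(x, y - 1), by simp [Grid], ⟨by simp only; linarith, by simp only; linarith⟩,
        by simp only; ring⟩
    · exact ⟨(x + 1, y), by simp [Grid], ⟨by simp only; linarith, by simp only; linarith⟩,
        by simp only; ring⟩

/-- The digital line between two of its points, as a sequence of grid points. -/
theorem Mem.exists_seq (hp : 0 ≤ ℓ.p) (hu : ℓ.Mem u) (hv : ℓ.Mem v)
    (h : ℓ.progress u ≤ ℓ.progress v) :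
    ∃ (K : ℕ) (γ : ℕ → ℤ × ℤ), γ 0 = u ∧ γ K = v ∧ (∀ k, ℓ.Mem (γ k)) ∧
      (∀ k, Grid.Adj (γ k) (γ (k + 1))) ∧ ∀ k, ℓ.progress (γ k) = ℓ.progress u + k := by
  have : ∀ w, ∃ w', ℓ.Mem w → Grid.Adj w w' ∧ ℓ.Mem w' ∧ ℓ.progress w' = ℓ.progress w + 1 := by
    intro w
    by_cases hw : ℓ.Mem w
    · obtain ⟨w', hw'⟩ := hw.exists_succ hp
      exact ⟨w', fun _ => hw'⟩
    · exact ⟨w, fun h => absurd h hw⟩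
  choose next hnext using this
  have hmem : ∀ k, ℓ.Mem (next^[k] u) := by
    intro k
    induction k with
    | zero => exact hu
    | succ k ih => rw [Function.iterate_succ_apply']; exact (hnext _ ih).2.1
  have hprog : ∀ k : ℕ, ℓ.progress (next^[k] u) = ℓ.progress u + k := by
    intro k
    induction k with
    | zero => simp
    | succ k ih =>
      rw [Function.iterate_succ_apply', (hnext _ (hmem k)).2.2, ih]; push_cast; ring
  refine ⟨(ℓ.progress v - ℓ.progress u).toNat, fun k => next^[k] u, rfl, ?_, hmem, ?_, hprog⟩
  · refine (hmem _).eq_of_progress_eq hp hv ?_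
    rw [hprog, Int.toNat_of_nonneg (by omega)]
    ring
  · intro k
    simp only [Function.iterate_succ_apply']
    exact (hnext _ (hmem k)).1

/-- The number of points of a digital line in a set of bounded extent along the line. -/
theorem card_le_of_progress (hp : 0 ≤ ℓ.p) {s : Finset (ℤ × ℤ)} (hs : ∀ v ∈ s, ℓ.Mem v) {L : ℕ}
    (hL : ∀ u ∈ s, ∀ v ∈ s, ℓ.progress v - ℓ.progress u ≤ L) : s.card ≤ L + 1 := by
  rcases s.eq_empty_or_nonempty with rfl | hne
  · simp
  obtain ⟨u, hu, hmin⟩ := s.exists_min_image ℓ.progress hne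
  have : s.card ≤ (Finset.Icc (ℓ.progress u) (ℓ.progress u + L)).card := by
    refine Finset.card_le_card_of_injOn ℓ.progress ?_ ?_
    · intro v hv
      have := hL u hu v hv
      exact Finset.mem_coe.2 (Finset.mem_Icc.2 ⟨hmin v hv, by omega⟩)
    · intro v hv w hw h
      exact (hs v hv).eq_of_progress_eq hp (hs w hw) h
  rw [Int.card_Icc] at this
  omega

theorem abs_progress_sub_le (u v : ℤ × ℤ) :
    |ℓ.progress v - ℓ.progress u| ≤ |v.1 - u.1| + |v.2 - u.2| := by
  unfold progress
  rcases ℓ.slopeSign_eq with e | e <;> rw [e] <;> grind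

/-- The squared Euclidean length of the direction. -/
def normSq (ℓ : GridLine) : ℝ := (ℓ.p : ℝ) ^ 2 + (ℓ.q : ℝ) ^ 2

/-- The orthogonal projection of a grid point onto the line. -/
noncomputable def foot (ℓ : GridLine) (v : ℤ × ℤ) : EuclideanSpace ℝ (Fin 2) :=
  toPlane v - ((ℓ.val v : ℝ) / ℓ.normSq) • !₂[(ℓ.q : ℝ), -(ℓ.p : ℝ)]

theorem normSq_pos (h : 0 < ℓ.height) : 0 < ℓ.normSq := by
  unfold normSq
  rcases direction_ne_zero h with h | h
  · have : (ℓ.p : ℝ) ≠ 0 := by exact_mod_cast h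
    positivity
  · have : (ℓ.q : ℝ) ≠ 0 := by exact_mod_cast h
    positivity

theorem norm_foot_sub_foot (h : 0 < ℓ.height) (u v : ℤ × ℤ) :
    ‖ℓ.foot u - ℓ.foot v‖
      = |(ℓ.p : ℝ) * (u.1 - v.1) + ℓ.q * (u.2 - v.2)| / √ℓ.normSq := by
  have hN := normSq_pos h
  rw [← Real.sqrt_sq_eq_abs, ← Real.sqrt_div (sq_nonneg _), EuclideanSpace.norm_eq]
  congr 1
  simp only [foot, toPlane, Fin.sum_univ_two, PiLp.sub_apply, PiLp.smul_apply, val,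
    Matrix.cons_val_zero, Matrix.cons_val_one, Real.norm_eq_abs, sq_abs, smul_eq_mul]
  push_cast
  field_simp
  unfold normSq
  ring

theorem norm_foot_sub_toPlane (h : 0 < ℓ.height) (v : ℤ × ℤ) :
    ‖ℓ.foot v - toPlane v‖ = |(ℓ.val v : ℝ)| / √ℓ.normSq := by
  have hN := normSq_pos h
  rw [← Real.sqrt_sq_eq_abs, ← Real.sqrt_div (sq_nonneg _), EuclideanSpace.norm_eq]
  congr 1
  simp only [foot, toPlane, Fin.sum_univ_two, PiLp.sub_apply, PiLp.smul_apply,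
    Matrix.cons_val_zero, Matrix.cons_val_one, Real.norm_eq_abs, sq_abs, smul_eq_mul]
  field_simp
  unfold normSq
  ring

/-- Points of the digital line are even within `1 / √2` of the line. -/
theorem Mem.norm_foot_sub_le (h : 0 < ℓ.height) (hv : ℓ.Mem v) :
    ‖ℓ.foot v - toPlane v‖ ≤ 3 / 4 := by
  have hN := normSq_pos h
  rw [norm_foot_sub_toPlane h, div_le_iff₀ (Real.sqrt_pos.2 hN)]
  have h1 : 2 * |(ℓ.val v : ℝ)| ≤ |(ℓ.p : ℝ)| + |(ℓ.q : ℝ)| := by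
    have : 2 * |ℓ.val v| ≤ |ℓ.p| + |ℓ.q| := by
      have := hv.1; have := hv.2
      rcases abs_cases (ℓ.val v) with h | h <;> linarith
    exact_mod_cast this
  have h2 : (|(ℓ.p : ℝ)| + |(ℓ.q : ℝ)|) / (3 / 2) ≤ √ℓ.normSq := by
    apply Real.le_sqrt_of_sq_le
    unfold normSq
    rw [← sq_abs (ℓ.p : ℝ), ← sq_abs (ℓ.q : ℝ)]
    nlinarith [sq_nonneg (|(ℓ.p : ℝ)| - |(ℓ.q : ℝ)|), sq_nonneg |(ℓ.p : ℝ)|,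
      sq_nonneg |(ℓ.q : ℝ)|]
  linarith

/-- Projecting two points of a digital line onto the line shortens their distance by at most
one: if one displacement component has the wrong sign, the strip is left. -/
theorem Mem.norm_sub_le (h : 0 < ℓ.height) (hu : ℓ.Mem u) (hv : ℓ.Mem v) :
    ‖toPlane u - toPlane v‖ ≤ ‖ℓ.foot u - ℓ.foot v‖ + 1 := by
  have hN := normSq_pos h
  have hs := Real.sqrt_pos.2 hN
  rw [norm_foot_sub_foot h, toPlane_sub_norm]
  have hlt := abs_val_sub_lt hu hv
  have hint : (u.1 - v.1 = 0 ∧ u.2 - v.2 = 0) ∨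
      |ℓ.p| ≤ |ℓ.p * (u.1 - v.1) + ℓ.q * (u.2 - v.2)| ∨
      |ℓ.q| ≤ |ℓ.p * (u.1 - v.1) + ℓ.q * (u.2 - v.2)| := by
    generalize u.1 - v.1 = a at *
    generalize u.2 - v.2 = b at *
    by_cases hsign : 0 ≤ (ℓ.p * a) * (ℓ.q * b)
    · rw [abs_add_eq_add_abs_iff _ _ |>.2 (by
        rcases le_total 0 (ℓ.p * a) with h1 | h1 <;> rcases le_total 0 (ℓ.q * b) with h2 | h2
        · exact .inl ⟨h1, h2⟩
        · rcases mul_nonneg_iff.1 hsign with h3 | h3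
          · exact .inl h3
          · exact .inr h3
        · rcases mul_nonneg_iff.1 hsign with h3 | h3
          · exact .inl h3
          · exact .inr h3
        · exact .inr ⟨h1, h2⟩), abs_mul, abs_mul]
      by_cases ha : a = 0
      · by_cases hb : b = 0
        · exact .inl ⟨ha, hb⟩
        · right; right
          have := Int.one_le_abs hb
          nlinarith [abs_nonneg ℓ.q, abs_nonneg ℓ.p, abs_nonneg a]
      · right; left
        have := Int.one_le_abs ha
        nlinarith [abs_nonneg ℓ.q, abs_nonneg ℓ.p, abs_nonneg b]
    · exfalso
      push Not at hsign
      have ha : a ≠ 0 := by rintro rfl; simp at hsign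
      have hb : b ≠ 0 := by rintro rfl; simp at hsign
      have e : |ℓ.q * a - ℓ.p * b| = |ℓ.q * a| + |ℓ.p * b| := by
        rw [sub_eq_add_neg, ← abs_neg (ℓ.p * b), abs_add_eq_add_abs_iff]
        have : 0 < (ℓ.q * a) * (-(ℓ.p * b)) := by nlinarith
        rcases pos_and_pos_or_neg_and_neg_of_mul_pos this with h | h
        · exact .inl ⟨h.1.le, h.2.le⟩
        · exact .inr ⟨h.1.le, h.2.le⟩
      rw [e, abs_mul, abs_mul] at hlt
      nlinarith [Int.one_le_abs ha, Int.one_le_abs hb, abs_nonneg ℓ.q, abs_nonneg ℓ.p]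
  rcases hint with ⟨h1, h2⟩ | hint
  · rw [h1, h2]
    simp
    positivity
  push_cast at *
  have hlt' : |(ℓ.q : ℝ) * (u.1 - v.1) - ℓ.p * (u.2 - v.2)| < |(ℓ.p : ℝ)| + |(ℓ.q : ℝ)| := by
    exact_mod_cast hlt
  have hint' : |(ℓ.p : ℝ)| ≤ |(ℓ.p : ℝ) * (u.1 - v.1) + ℓ.q * (u.2 - v.2)| ∨
      |(ℓ.q : ℝ)| ≤ |(ℓ.p : ℝ) * (u.1 - v.1) + ℓ.q * (u.2 - v.2)| := by
    exact_mod_cast hint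
  set a : ℝ := (u.1 : ℝ) - v.1
  set b : ℝ := (u.2 : ℝ) - v.2
  set N := √ℓ.normSq with hNdef
  set T := |(ℓ.p : ℝ) * a + ℓ.q * b|
  have hNN : N ^ 2 = (ℓ.p : ℝ) ^ 2 + (ℓ.q : ℝ) ^ 2 := Real.sq_sqrt hN.le
  have hpN : |(ℓ.p : ℝ)| ≤ N := abs_le_of_sq_le_sq (by nlinarith [sq_nonneg (ℓ.q : ℝ)]) hs.le
  have hqN : |(ℓ.q : ℝ)| ≤ N := abs_le_of_sq_le_sq (by nlinarith [sq_nonneg (ℓ.p : ℝ)]) hs.le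
  have hpq : |(ℓ.p : ℝ)| * |(ℓ.q : ℝ)| ≤ N * T := by
    rcases hint' with h | h
    · rw [mul_comm]
      exact mul_le_mul hqN h (abs_nonneg _) hs.le
    · exact mul_le_mul hpN h (abs_nonneg _) hs.le
  apply Real.sqrt_le_iff.2
  refine ⟨by positivity, ?_⟩
  have hsq : ((ℓ.q : ℝ) * a - ℓ.p * b) ^ 2 ≤ (|(ℓ.p : ℝ)| + |(ℓ.q : ℝ)|) ^ 2 := by
    rw [← sq_abs]
    exact pow_le_pow_left₀ (abs_nonneg _) hlt'.le 2
  have hTsq : T ^ 2 = ((ℓ.p : ℝ) * a + ℓ.q * b) ^ 2 := sq_abs _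
  have hmain : (a ^ 2 + b ^ 2) * N ^ 2 ≤ (T + N) ^ 2 := by
    have : (a ^ 2 + b ^ 2) * N ^ 2 = T ^ 2 + ((ℓ.q : ℝ) * a - ℓ.p * b) ^ 2 := by
      rw [hTsq, hNN]; ring
    rw [this]
    nlinarith [sq_abs (ℓ.p : ℝ), sq_abs (ℓ.q : ℝ)]
  have : T / N + 1 = (T + N) / N := by field_simp
  rw [this, div_pow, le_div_iff₀ (by positivity)]
  exact hmain

end GridLine

/-! ### Ownership of grid points -/

namespace GridLine

/-- The lines of level `n`: rational directions of height dividing `2 ^ n`, which are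
`2 ^ (-n)`-dense among all directions, and for each direction the parallels that meet a coordinate
axis at multiples of `2 ^ (16 n)`. -/
def family (n : ℕ) : Set GridLine :=
  {ℓ | ℓ.Normalized ∧ ℓ.height ∣ 2 ^ n ∧ 2 ^ (16 * n) * ℓ.height ∣ ℓ.c}

end GridLine

open GridLine

/-- The index of the cell of level `i` containing a grid point; cells are squares of side
`2 ^ (6 i)`. -/
def cell (i : ℕ) (v : ℤ × ℤ) : ℤ × ℤ := (v.1 / 2 ^ (6 * i), v.2 / 2 ^ (6 * i))

/-- One of the four cells at the origin. -/
def Central (κ : ℤ × ℤ) : Prop := (-1 ≤ κ.1 ∧ κ.1 ≤ 0) ∧ (-1 ≤ κ.2 ∧ κ.2 ≤ 0)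

/-- The digital line passes through the cell of level `i` with index `κ`. -/
def Meets (ℓ : GridLine) (i : ℕ) (κ : ℤ × ℤ) : Prop := ∃ w, cell i w = κ ∧ ℓ.Mem w

open Classical in
/-- The line that owns a cell of level `i`, given the line `B` owning its parent cell: `B` if it
passes through the cell, and otherwise some line of level `i` passing through it. The four cells at
the origin are kept free. -/
noncomputable def inherit (i : ℕ) (κ : ℤ × ℤ) (B : Option GridLine) : Option GridLine :=
  if Central κ then none
  else if ∃ ℓ, B = some ℓ ∧ Meets ℓ i κ then B
  else if h : ∃ ℓ ∈ family i, Meets ℓ i κ then some h.choose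
  else none

/-- The owner of the cell of level `i` containing `v` when ownership is passed down from level
`i + k`. -/
noncomputable def ownerFrom : ℕ → ℕ → ℤ × ℤ → Option GridLine
  | 0, _, _ => none
  | k + 1, i, v => inherit i (cell i v) (ownerFrom k (i + 1) v)

/-- The line owning the cell of level `i` that contains `v`. Cells of level at least
`|v.1| + |v.2|` around `v` are central, so nothing is inherited from beyond that level. -/
noncomputable def owner (i : ℕ) (v : ℤ × ℤ) : Option GridLine :=
  ownerFrom (v.1.natAbs + v.2.natAbs) i v

theorem central_cell {v : ℤ × ℤ} {i : ℕ} (h : v.1.natAbs + v.2.natAbs ≤ i) :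
    Central (cell i v) := by
  have hpow : (i : ℤ) < 2 ^ (6 * i) := by
    have h1 : i < 2 ^ i := Nat.lt_two_pow_self
    have h2 : 2 ^ i ≤ 2 ^ (6 * i) := Nat.pow_le_pow_right (by norm_num) (by omega)
    exact_mod_cast h1.trans_le h2
  have hpos : (0 : ℤ) < 2 ^ (6 * i) := by positivity
  have aux : ∀ x : ℤ, x.natAbs ≤ i → -1 ≤ x / 2 ^ (6 * i) ∧ x / 2 ^ (6 * i) ≤ 0 := by
    intro x hx
    constructor
    · rw [Int.le_ediv_iff_mul_le hpos]; omega
    · exact Int.le_of_lt_add_one ((Int.ediv_lt_iff_lt_mul hpos).2 (by omega))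
  exact ⟨aux _ (by omega), aux _ (by omega)⟩

theorem cell_succ_eq {i j : ℕ} (hij : i ≤ j) {v w : ℤ × ℤ} (h : cell i v = cell i w) :
    cell j v = cell j w := by
  obtain ⟨k, rfl⟩ := Nat.exists_eq_add_of_le hij
  have aux : ∀ x : ℤ, x / 2 ^ (6 * (i + k)) = x / 2 ^ (6 * i) / 2 ^ (6 * k) := by
    intro x
    rw [Int.ediv_ediv_of_nonneg (by positivity), ← pow_add]
    ring_nf
  simp only [cell, Prod.mk.injEq] at h ⊢
  rw [aux, aux, aux, aux, h.1, h.2]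
  exact ⟨rfl, rfl⟩

theorem Central.of_le {i j : ℕ} (hij : i ≤ j) {v : ℤ × ℤ} (h : Central (cell i v)) :
    Central (cell j v) := by
  obtain ⟨k, rfl⟩ := Nat.exists_eq_add_of_le hij
  have hpos : (0 : ℤ) < 2 ^ (6 * k) := by positivity
  have aux : ∀ x : ℤ, -1 ≤ x / 2 ^ (6 * i) ∧ x / 2 ^ (6 * i) ≤ 0 →
      -1 ≤ x / 2 ^ (6 * (i + k)) ∧ x / 2 ^ (6 * (i + k)) ≤ 0 := by
    intro x hx
    have e : x / 2 ^ (6 * (i + k)) = x / 2 ^ (6 * i) / 2 ^ (6 * k) := by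
      rw [Int.ediv_ediv_of_nonneg (by positivity), ← pow_add]
      ring_nf
    rw [e]
    constructor
    · rw [Int.le_ediv_iff_mul_le hpos]; omega
    · exact Int.le_of_lt_add_one ((Int.ediv_lt_iff_lt_mul hpos).2 (by omega))
  exact ⟨aux _ h.1, aux _ h.2⟩

theorem ownerFrom_succ {v : ℤ × ℤ} {k i : ℕ} (h : v.1.natAbs + v.2.natAbs ≤ i + k) :
    ownerFrom (k + 1) i v = ownerFrom k i v := by
  induction k generalizing i with
  | zero => simp [ownerFrom, inherit, central_cell (i := i) (by simpa using h)]
  | succ k ih =>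
    rw [ownerFrom, ih (by omega), ← ownerFrom]

theorem ownerFrom_eq_owner {v : ℤ × ℤ} {k : ℕ} (h : v.1.natAbs + v.2.natAbs ≤ k) (i : ℕ) :
    ownerFrom k i v = owner i v := by
  induction k, h using Nat.le_induction with
  | base => rfl
  | succ k hk ih => rw [ownerFrom_succ (by omega), ih]

theorem owner_eq (i : ℕ) (v : ℤ × ℤ) :
    owner i v = inherit i (cell i v) (owner (i + 1) v) := by
  rw [← ownerFrom_eq_owner (Nat.le_succ _), ownerFrom, owner]

theorem ownerFrom_congr {i k : ℕ} {v w : ℤ × ℤ} (h : cell i v = cell i w) :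
    ownerFrom k i v = ownerFrom k i w := by
  induction k generalizing i with
  | zero => rfl
  | succ k ih => rw [ownerFrom, ownerFrom, h, ih (cell_succ_eq (Nat.le_succ i) h)]

theorem owner_congr {i : ℕ} {v w : ℤ × ℤ} (h : cell i v = cell i w) : owner i v = owner i w := by
  rw [← ownerFrom_eq_owner (le_max_left _ (w.1.natAbs + w.2.natAbs)), ownerFrom_congr h,
    ownerFrom_eq_owner (le_max_right _ _)]

theorem inherit_eq_some {i : ℕ} {κ : ℤ × ℤ} {B : Option GridLine} {ℓ : GridLine}
    (h : inherit i κ B = some ℓ) : ¬ Central κ ∧ Meets ℓ i κ ∧ (B = some ℓ ∨ ℓ ∈ family i) := by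
  unfold inherit at h
  split_ifs at h with h1 h2 h3
  · obtain ⟨ℓ', rfl, h'⟩ := h2
    obtain rfl := Option.some.inj h
    exact ⟨h1, h', .inl rfl⟩
  · obtain rfl := Option.some.inj h
    exact ⟨h1, h3.choose_spec.2, .inr h3.choose_spec.1⟩

theorem owner_meets {i : ℕ} {v : ℤ × ℤ} {ℓ : GridLine} (h : owner i v = some ℓ) :
    Meets ℓ i (cell i v) := (inherit_eq_some (owner_eq i v ▸ h)).2.1

theorem owner_origin {i m : ℕ} (him : i ≤ m) {v : ℤ × ℤ} {ℓ : GridLine}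
    (h : owner i v = some ℓ) :
    (∃ j, i ≤ j ∧ j < m ∧ ℓ ∈ family j) ∨ owner m v = some ℓ := by
  induction m, him using Nat.le_induction with
  | base => exact .inr h
  | succ m hm ih =>
    rcases ih with ⟨j, h1, h2, h3⟩ | h'
    · exact .inl ⟨j, h1, by omega, h3⟩
    · rcases (inherit_eq_some (owner_eq m v ▸ h')).2.2 with h2 | h2
      · exact .inr h2
      · exact .inl ⟨m, hm, by omega, h2⟩

theorem exists_mem_family_of_owner {i : ℕ} {v : ℤ × ℤ} {ℓ : GridLine} (h : owner i v = some ℓ) :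
    ∃ j, ℓ ∈ family j := by
  rcases owner_origin (le_max_left i (v.1.natAbs + v.2.natAbs)) h with ⟨j, -, -, hj⟩ | h'
  · exact ⟨j, hj⟩
  · rw [owner_eq, inherit, if_pos (central_cell (le_max_right _ _))] at h'
    cases h'

theorem cell_zero (v : ℤ × ℤ) : cell 0 v = v := by simp [cell]

theorem mem_of_owner {v : ℤ × ℤ} {ℓ : GridLine} (h : owner 0 v = some ℓ) : ℓ.Mem v := by
  obtain ⟨w, hw, hm⟩ := owner_meets h
  rw [cell_zero, cell_zero] at hw
  exact hw ▸ hm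

/-- A line owning a cell owns all points of its digitization in that cell. -/
theorem owner_persists {n : ℕ} {v : ℤ × ℤ} {ℓ : GridLine} (hv : ℓ.Mem v)
    (h : owner n v = some ℓ) : owner 0 v = some ℓ := by
  induction n with
  | zero => exact h
  | succ n ih =>
    apply ih
    have hc : ¬ Central (cell n v) := fun hc =>
      (inherit_eq_some (owner_eq (n + 1) v ▸ h)).1 (hc.of_le (Nat.le_succ n))
    rw [owner_eq, inherit, if_neg hc, if_pos ⟨ℓ, h, v, rfl, hv⟩, h]

/-- The ways in which a line of level `n` can lose one of its points to another line. -/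
theorem owner_ne {n : ℕ} {v : ℤ × ℤ} {ℓ : GridLine} (hℓ : ℓ ∈ family n) (hv : ℓ.Mem v)
    (h : owner 0 v ≠ some ℓ) {m : ℕ} (hm : n < m) :
    Central (cell n v) ∨ ∃ ℓ', ℓ' ≠ ℓ ∧ Meets ℓ' n (cell n v) ∧
      ((∃ j, n ≤ j ∧ j < m ∧ ℓ' ∈ family j) ∨ owner m v = some ℓ') := by
  by_cases hc : Central (cell n v)
  · exact .inl hc
  right
  obtain ⟨ℓ', hℓ'⟩ : ∃ ℓ', owner n v = some ℓ' := by
    rw [owner_eq, inherit, if_neg hc]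
    have hex : ∃ ℓ ∈ family n, Meets ℓ n (cell n v) := ⟨ℓ, hℓ, v, rfl, hv⟩
    split_ifs with h1
    · exact ⟨_, h1.choose_spec.1⟩
    · exact ⟨_, rfl⟩
  refine ⟨ℓ', ?_, owner_meets hℓ', owner_origin hm.le hℓ'⟩
  rintro rfl
  exact h (owner_persists hv hℓ')

/-! ### Counting the points a line loses -/

/-- The grid points at sup-distance at most `R` from `o`. -/
def InBox (o : ℤ × ℤ) (R : ℤ) (v : ℤ × ℤ) : Prop := |v.1 - o.1| ≤ R ∧ |v.2 - o.2| ≤ R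

namespace GridLine

variable {ℓ ℓ' : GridLine} {u v w : ℤ × ℤ}

/-- The line comes as close to `v` as it must if it passes through the cell of level `n`
around `v`. -/
def Near (ℓ : GridLine) (n : ℕ) (v : ℤ × ℤ) : Prop := |ℓ.val v| ≤ 3 * 2 ^ (6 * n) * ℓ.height

theorem Mem.abs_val_le (hv : ℓ.Mem v) : |ℓ.val v| ≤ ℓ.height := by
  have := hv.1; have := hv.2; have := ℓ.abs_p_le; have := ℓ.abs_q_le
  rw [abs_le]; constructor <;> linarith

theorem height_nonneg (ℓ : GridLine) : 0 ≤ ℓ.height := (abs_nonneg _).trans ℓ.abs_p_le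

theorem abs_combination_le (ℓ : GridLine) {x y a b : ℤ} (hx : |x| ≤ a) (hy : |y| ≤ b) :
    |ℓ.q * x - ℓ.p * y| ≤ ℓ.height * a + ℓ.height * b := by
  refine (abs_sub _ _).trans (add_le_add ?_ ?_) <;> rw [abs_mul]
  · exact mul_le_mul ℓ.abs_q_le hx (abs_nonneg _) ℓ.height_nonneg
  · exact mul_le_mul ℓ.abs_p_le hy (abs_nonneg _) ℓ.height_nonneg

theorem abs_sub_le_of_ediv_eq {x y r : ℤ} (hr : 0 < r) (h : x / r = y / r) : |x - y| ≤ r := by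
  have h1 := Int.mul_ediv_add_emod x r
  have h2 := Int.mul_ediv_add_emod y r
  have h3 := Int.emod_nonneg x hr.ne'
  have h4 := Int.emod_nonneg y hr.ne'
  have h5 := Int.emod_lt_of_pos x hr
  have h6 := Int.emod_lt_of_pos y hr
  rw [h] at h1
  rw [abs_le]; constructor <;> linarith

theorem near_of_meets {n : ℕ} (h : Meets ℓ n (cell n v)) : ℓ.Near n v := by
  obtain ⟨w, hw, hm⟩ := h
  have hr : (0 : ℤ) < 2 ^ (6 * n) := by positivity
  simp only [cell, Prod.mk.injEq] at hw
  have h1 := ℓ.abs_combination_le (abs_sub_le_of_ediv_eq hr hw.1.symm)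
    (abs_sub_le_of_ediv_eq hr hw.2.symm)
  have e : ℓ.val v = (ℓ.q * (v.1 - w.1) - ℓ.p * (v.2 - w.2)) + ℓ.val w := by
    simp only [val]; ring
  have h2 := abs_add_le (ℓ.q * (v.1 - w.1) - ℓ.p * (v.2 - w.2)) (ℓ.val w)
  have h3 := hm.abs_val_le
  have h4 : ℓ.height * 1 ≤ ℓ.height * 2 ^ (6 * n) :=
    mul_le_mul_of_nonneg_left (by omega) ℓ.height_nonneg
  unfold Near
  rw [e]
  linarith

/-- A displacement almost parallel to two transversal lines is short; `α` and `β` bound its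
deviation from the two directions. -/
theorem abs_det_mul_le {x y α β : ℤ} (hα : |ℓ.q * x - ℓ.p * y| ≤ α)
    (hβ : |ℓ'.q * x - ℓ'.p * y| ≤ β) :
    |det ℓ ℓ'| * |x| ≤ ℓ'.height * α + ℓ.height * β ∧
      |det ℓ ℓ'| * |y| ≤ ℓ'.height * α + ℓ.height * β := by
  have ex : det ℓ ℓ' * x
      = ℓ'.p * (ℓ.q * x - ℓ.p * y) - ℓ.p * (ℓ'.q * x - ℓ'.p * y) := by unfold det; ring
  have ey : det ℓ ℓ' * y
      = ℓ'.q * (ℓ.q * x - ℓ.p * y) - ℓ.q * (ℓ'.q * x - ℓ'.p * y) := by unfold det; ring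
  rw [← abs_mul, ← abs_mul, ex, ey]
  constructor <;> refine (abs_sub _ _).trans (add_le_add ?_ ?_) <;> rw [abs_mul]
  · exact mul_le_mul ℓ'.abs_p_le hα (abs_nonneg _) ℓ'.height_nonneg
  · exact mul_le_mul ℓ.abs_p_le hβ (abs_nonneg _) ℓ.height_nonneg
  · exact mul_le_mul ℓ'.abs_q_le hα (abs_nonneg _) ℓ'.height_nonneg
  · exact mul_le_mul ℓ.abs_q_le hβ (abs_nonneg _) ℓ.height_nonneg

theorem Near.abs_sub_le {n : ℕ} (hu : ℓ.Near n u) (hv : ℓ.Near n v) :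
    |ℓ.q * (v.1 - u.1) - ℓ.p * (v.2 - u.2)| ≤ 6 * 2 ^ (6 * n) * ℓ.height := by
  have e : ℓ.q * (v.1 - u.1) - ℓ.p * (v.2 - u.2) = ℓ.val v - ℓ.val u := by
    simp only [val]; ring
  rw [e]
  unfold Near at hu hv
  have := abs_sub (ℓ.val v) (ℓ.val u)
  linarith

theorem Mem.abs_sub_le (hu : ℓ.Mem u) (hv : ℓ.Mem v) :
    |ℓ.q * (v.1 - u.1) - ℓ.p * (v.2 - u.2)| ≤ 2 * ℓ.height := by
  have := abs_val_sub_lt hv hu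
  have := ℓ.abs_p_le; have := ℓ.abs_q_le
  linarith

/-- A transversal line stays close to a digital line only along a stretch whose length is inversely
proportional to the angle between them. -/
theorem progress_sub_le_of_near {n : ℕ} {T : ℤ} (hu : ℓ.Mem u) (hv : ℓ.Mem v)
    (nu : ℓ'.Near n u) (nv : ℓ'.Near n v) (hd : det ℓ ℓ' ≠ 0)
    (hT : ℓ.height * ℓ'.height ≤ |det ℓ ℓ'| * T) :
    ℓ.progress v - ℓ.progress u ≤ 16 * 2 ^ (6 * n) * T := by
  have hr : (1 : ℤ) ≤ 2 ^ (6 * n) := one_le_pow₀ (by norm_num)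
  obtain ⟨hx, hy⟩ := abs_det_mul_le (hu.abs_sub_le hv) (nu.abs_sub_le nv)
  have hD : 0 < |det ℓ ℓ'| := abs_pos.2 hd
  have hMM : 0 ≤ ℓ.height * ℓ'.height := mul_nonneg ℓ.height_nonneg ℓ'.height_nonneg
  have hb : ℓ'.height * (2 * ℓ.height) + ℓ.height * (6 * 2 ^ (6 * n) * ℓ'.height)
      ≤ |det ℓ ℓ'| * (8 * 2 ^ (6 * n) * T) := by
    have h1 : ℓ.height * ℓ'.height ≤ 2 ^ (6 * n) * (ℓ.height * ℓ'.height) :=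
      le_mul_of_one_le_left hMM hr
    have h2 : 2 ^ (6 * n) * (ℓ.height * ℓ'.height) ≤ 2 ^ (6 * n) * (|det ℓ ℓ'| * T) :=
      mul_le_mul_of_nonneg_left hT (by positivity)
    linarith
  have hx' := le_of_mul_le_mul_left (hx.trans hb) hD
  have hy' := le_of_mul_le_mul_left (hy.trans hb) hD
  have := (le_abs_self _).trans (ℓ.abs_progress_sub_le u v)
  linarith

theorem exists_height_eq {N : ℕ} (hN : ℓ.height ∣ 2 ^ N) :
    ∃ t ≤ N, ℓ.height = 2 ^ t := by
  have h1 : ℓ.height.natAbs ∣ 2 ^ N := by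
    have := Int.natAbs_dvd_natAbs.2 hN
    simpa [Int.natAbs_pow] using this
  obtain ⟨t, ht, e⟩ := (Nat.dvd_prime_pow Nat.prime_two).1 h1
  refine ⟨t, ht, ?_⟩
  rw [← Int.natAbs_of_nonneg ℓ.height_nonneg, e]
  push_cast
  rfl

theorem height_le_of_dvd {N : ℕ} (hN : ℓ.height ∣ 2 ^ N) :
    ℓ.height ≤ 2 ^ N := Int.le_of_dvd (by positivity) hN

/-- A finite set containing all directions of height dividing `2 ^ N`. -/
noncomputable def directions (N : ℕ) : Finset (ℤ × ℤ) :=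
  let pows := (Finset.range (N + 1)).image fun t => (2 : ℤ) ^ t
  let all := Finset.Icc (-2 ^ N : ℤ) (2 ^ N)
  (pows ×ˢ all) ∪ (all ×ˢ pows) ∪ (all ×ˢ pows.image fun x => -x)

theorem mem_directions (h : ℓ.Normalized) {N : ℕ} (hN : ℓ.height ∣ 2 ^ N) :
    (ℓ.p, ℓ.q) ∈ directions N := by
  obtain ⟨t, ht, e⟩ := exists_height_eq hN
  have hle := height_le_of_dvd hN
  have hp := abs_le.1 (ℓ.abs_p_le.trans hle)
  have hq := abs_le.1 (ℓ.abs_q_le.trans hle)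
  have hpow : (2 : ℤ) ^ t ∈ (Finset.range (N + 1)).image fun t => (2 : ℤ) ^ t :=
    Finset.mem_image.2 ⟨t, Finset.mem_range.2 (by omega), rfl⟩
  simp only [directions, Finset.mem_union, Finset.mem_product, Finset.mem_Icc]
  rcases max_choice |ℓ.p| |ℓ.q| with hm | hm <;> rw [← height, e] at hm
  · rw [abs_of_nonneg h.p_nonneg] at hm
    exact .inl (.inl ⟨hm ▸ hpow, hq⟩)
  · rcases abs_cases ℓ.q with ⟨h1, -⟩ | ⟨h1, -⟩
    · exact .inl (.inr ⟨hp, (hm.trans h1) ▸ hpow⟩)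
    · refine .inr ⟨hp, Finset.mem_image.2 ⟨_, hpow, ?_⟩⟩
      omega

theorem card_directions_le (N : ℕ) : (directions N).card ≤ 3 * ((N + 1) * 2 ^ (N + 2)) := by
  have hp : ((Finset.range (N + 1)).image fun t => (2 : ℤ) ^ t).card ≤ N + 1 :=
    Finset.card_image_le.trans (by simp)
  have ha : (Finset.Icc (-2 ^ N : ℤ) (2 ^ N)).card ≤ 2 ^ (N + 2) := by
    rw [Int.card_Icc]
    have h1 : (1 : ℤ) ≤ 2 ^ N := one_le_pow₀ (by norm_num)
    have e : (2 : ℤ) ^ (N + 2) = 4 * 2 ^ N := by ring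
    zify
    rw [Int.toNat_of_nonneg (by linarith), e]
    linarith
  unfold directions
  refine (Finset.card_union_le _ _).trans ((add_le_add_left (Finset.card_union_le _ _) _).trans ?_)
  rw [Finset.card_product, Finset.card_product, Finset.card_product]
  have h1 := Nat.mul_le_mul hp ha
  have h2 := Nat.mul_le_mul ha hp
  have h3 := Nat.mul_le_mul ha ((Finset.card_image_le (f := fun x : ℤ => -x)).trans hp)
  linarith

/-- Distinct parallel lines from the levels above `n` are too far apart to interfere at the scale
of the cells of level `n`. -/
theorem det_ne_zero_of_near {n j : ℕ} (hn : 1 ≤ n) (hℓ : ℓ ∈ family n) (hj : n ≤ j)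
    (hℓ' : ℓ' ∈ family j) (hne : ℓ' ≠ ℓ) (hv : ℓ.Mem v) (hnear : ℓ'.Near n v) :
    det ℓ ℓ' ≠ 0 := by
  intro hd
  obtain ⟨hp, hq⟩ := hℓ.1.eq_of_det_eq_zero hℓ'.1 hd
  have hM : ℓ'.height = ℓ.height := by simp only [height, hp, hq]
  have hdvd : 2 ^ (16 * n) * ℓ.height ∣ ℓ'.c := by
    refine dvd_trans ?_ hℓ'.2.2
    rw [hM]
    exact mul_dvd_mul_right (pow_dvd_pow 2 (by omega)) _
  have hc : ℓ'.c - ℓ.c ≠ 0 := fun h => hne (GridLine.ext hp hq (sub_eq_zero.1 h))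
  have hbig := Int.le_of_dvd (abs_pos.2 hc) ((dvd_abs _ _).2 (dvd_sub hdvd hℓ.2.2))
  have e : ℓ'.c - ℓ.c = ℓ.val v - ℓ'.val v := by simp only [val, hp, hq]; ring
  have h1 := hv.abs_val_le
  unfold Near at hnear
  rw [hM] at hnear
  have h2 := abs_sub (ℓ.val v) (ℓ'.val v)
  rw [e] at hbig
  have h3 : (2 : ℤ) ^ (16 * n) ≥ 1024 * 2 ^ (6 * n) := by
    calc (2 : ℤ) ^ (16 * n) ≥ 2 ^ (6 * n + 10) := pow_le_pow_right₀ (by norm_num) (by omega)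
      _ = 1024 * 2 ^ (6 * n) := by ring
  have h4 : (1 : ℤ) ≤ 2 ^ (6 * n) := one_le_pow₀ (by norm_num)
  have hMpos := hℓ.1.height_pos
  nlinarith [mul_le_mul_of_nonneg_right h3 hMpos.le, mul_le_mul_of_nonneg_right h4 hMpos.le]

end GridLine

/-- The offset of a line among its parallels, relative to the one through `o`, in units of the
spacing `2 ^ (16 n)`. -/
def lineOffset (n : ℕ) (o : ℤ × ℤ) (ℓ : GridLine) : ℤ :=
  ℓ.c / (2 ^ (16 * n) * ℓ.height) - (ℓ.q * o.1 - ℓ.p * o.2) / (2 ^ (16 * n) * ℓ.height)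

theorem abs_lineOffset_le {n : ℕ} {o v : ℤ × ℤ} {ℓ : GridLine} (hℓ : ℓ.Normalized)
    (hc : 2 ^ (16 * n) * ℓ.height ∣ ℓ.c) (hv : InBox o (2 ^ (18 * n + 20)) v)
    (hnear : ℓ.Near n v) : |lineOffset n o ℓ| ≤ 2 ^ (2 * n + 22) := by
  have hM := hℓ.height_pos
  obtain ⟨k, hk⟩ := hc
  have hs : (0 : ℤ) < 2 ^ (16 * n) := by positivity
  have hsM := mul_pos hs hM
  unfold lineOffset
  rw [hk, Int.mul_ediv_cancel_left _ hsM.ne']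
  set B := ℓ.q * o.1 - ℓ.p * o.2 with hB
  have h1 := Int.mul_ediv_add_emod B (2 ^ (16 * n) * ℓ.height)
  have h2 := Int.emod_nonneg B hsM.ne'
  have h3 := Int.emod_lt_of_pos B hsM
  set kc := B / (2 ^ (16 * n) * ℓ.height)
  set ρ := B % (2 ^ (16 * n) * ℓ.height)
  have h4 := ℓ.abs_combination_le hv.1 hv.2
  unfold Near at hnear
  have e : 2 ^ (16 * n) * ℓ.height * (k - kc)
      = (ℓ.q * (v.1 - o.1) - ℓ.p * (v.2 - o.2)) - ℓ.val v + ρ := by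
    simp only [val]; rw [hk]; linarith
  have h5 : |2 ^ (16 * n) * ℓ.height * (k - kc)| ≤
      (ℓ.height * 2 ^ (18 * n + 20) + ℓ.height * 2 ^ (18 * n + 20))
        + 3 * 2 ^ (6 * n) * ℓ.height + 2 ^ (16 * n) * ℓ.height := by
    rw [e]
    refine (abs_add_le _ _).trans (add_le_add ((abs_sub _ _).trans (add_le_add h4 hnear)) ?_)
    rw [abs_of_nonneg h2]
    exact h3.le
  rw [abs_mul, abs_of_pos hsM] at h5
  have e1 : (2 : ℤ) ^ (18 * n + 20) = 2 ^ (16 * n) * (2 ^ (2 * n) * 2 ^ 20) := by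
    rw [← pow_add, ← pow_add]; congr 1; ring
  have e2 : (2 : ℤ) ^ (2 * n + 22) = 2 ^ (2 * n) * 2 ^ 22 := pow_add _ _ _
  have h6 : (2 : ℤ) ^ (6 * n) ≤ 2 ^ (16 * n) := pow_le_pow_right₀ (by norm_num) (by omega)
  have h7 : (1 : ℤ) ≤ 2 ^ (2 * n) := one_le_pow₀ (by norm_num)
  refine le_of_mul_le_mul_left (h5.trans ?_) hsM
  rw [e1, e2]
  nlinarith [mul_le_mul_of_nonneg_right h6 hM.le, mul_le_mul_of_nonneg_left h7 hsM.le]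

/-- The points of a line of level `n` that are close to other lines of comparable level. The bound
is (directions) × (parallels) × (length of one encounter). -/
theorem card_near_comparable_le {n : ℕ} (hn : 1 ≤ n) {ℓ : GridLine} (hℓ : ℓ ∈ family n)
    {o : ℤ × ℤ} {s : Finset (ℤ × ℤ)} (hs : ∀ v ∈ s, ℓ.Mem v)
    (hbox : ∀ v ∈ s, InBox o (2 ^ (18 * n + 20)) v)
    (hnear : ∀ v ∈ s, ∃ ℓ', ℓ' ≠ ℓ ∧ ℓ'.Near n v ∧ ∃ j, n ≤ j ∧ j < 3 * n + 4 ∧ ℓ' ∈ family j) :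
    s.card ≤ 2 ^ (16 * n + 41) := by
  have : Nonempty GridLine := ⟨ℓ⟩
  choose! L hLne hLnear hL using hnear
  have hLnorm : ∀ v ∈ s, (L v).Normalized := fun v hv => by
    obtain ⟨j, -, -, h⟩ := hL v hv; exact h.1
  have hLheight : ∀ v ∈ s, (L v).height ∣ 2 ^ (3 * n + 3) := fun v hv => by
    obtain ⟨j, -, hj, h⟩ := hL v hv; exact h.2.1.trans (pow_dvd_pow 2 (by omega))
  have hLc : ∀ v ∈ s, 2 ^ (16 * n) * (L v).height ∣ (L v).c := fun v hv => by
    obtain ⟨j, hj, -, h⟩ := hL v hv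
    exact (mul_dvd_mul_right (pow_dvd_pow 2 (by omega)) _).trans h.2.2
  have hdet : ∀ v ∈ s, det ℓ (L v) ≠ 0 := fun v hv => by
    obtain ⟨j, hj, -, h⟩ := hL v hv
    exact det_ne_zero_of_near hn hℓ hj h (hLne v hv) (hs v hv) (hLnear v hv)
  let key : ℤ × ℤ → (ℤ × ℤ) × ℤ := fun v => (((L v).p, (L v).q), lineOffset n o (L v))
  let target := directions (3 * n + 3) ×ˢ
    Finset.Icc (-2 ^ (2 * n + 22) : ℤ) (2 ^ (2 * n + 22))
  have hmaps : ∀ v ∈ s, key v ∈ target := fun v hv => by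
    refine Finset.mem_product.2 ⟨mem_directions (hLnorm v hv) (hLheight v hv), ?_⟩
    exact Finset.mem_Icc.2 (abs_le.1 (abs_lineOffset_le (hLnorm v hv) (hLc v hv) (hbox v hv)
      (hLnear v hv)))
  have hinj : ∀ v ∈ s, ∀ w ∈ s, key v = key w → L v = L w := by
    intro v hv w hw h
    simp only [key, Prod.mk.injEq] at h
    obtain ⟨⟨hp, hq⟩, hk⟩ := h
    have hM : (L v).height = (L w).height := by simp only [height, hp, hq]
    refine GridLine.ext hp hq ?_
    simp only [lineOffset, hp, hq, hM, sub_left_inj] at hk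
    have h1 := Int.mul_ediv_cancel' (hLc v hv)
    rw [hM, hk, Int.mul_ediv_cancel' (hLc w hw)] at h1
    exact h1.symm
  have hfiber : ∀ κ ∈ target, (s.filter fun v => key v = κ).card ≤ 2 ^ (10 * n + 7) + 1 := by
    intro κ _
    refine card_le_of_progress hℓ.1.p_nonneg (fun v hv => hs v (Finset.mem_filter.1 hv).1) ?_
    intro u hu v hv
    rw [Finset.mem_filter] at hu hv
    have hLL : L u = L v := hinj u hu.1 v hv.1 (hu.2.trans hv.2.symm)
    have hT : ℓ.height * (L v).height ≤ |det ℓ (L v)| * 2 ^ (4 * n + 3) := by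
      have h1 := height_le_of_dvd hℓ.2.1
      have h2 := height_le_of_dvd (hLheight v hv.1)
      calc ℓ.height * (L v).height ≤ 2 ^ n * 2 ^ (3 * n + 3) :=
            mul_le_mul h1 h2 (L v).height_nonneg (by positivity)
        _ = 2 ^ (4 * n + 3) := by rw [← pow_add]; congr 1; ring
        _ ≤ _ := le_mul_of_one_le_left (by positivity) (Int.one_le_abs (hdet v hv.1))
    have := progress_sub_le_of_near (hs u hu.1) (hs v hv.1) (hLL ▸ hLnear u hu.1)
      (hLnear v hv.1) (hdet v hv.1) hT
    refine this.trans (le_of_eq ?_)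
    push_cast
    rw [show (16 : ℤ) = 2 ^ 4 by norm_num, ← pow_add, ← pow_add]
    congr 1
    ring
  refine (Finset.card_le_mul_card_image_of_maps_to hmaps _ hfiber).trans ?_
  have h1 := card_directions_le (3 * n + 3)
  have h2 : (Finset.Icc (-2 ^ (2 * n + 22) : ℤ) (2 ^ (2 * n + 22))).card ≤ 2 ^ (2 * n + 24) := by
    rw [Int.card_Icc]
    have h1 : (1 : ℤ) ≤ 2 ^ (2 * n + 22) := one_le_pow₀ (by norm_num)
    have e : (2 : ℤ) ^ (2 * n + 24) = 4 * 2 ^ (2 * n + 22) := by ring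
    zify
    rw [Int.toNat_of_nonneg (by linarith), e]
    linarith
  have h3 : 3 * n + 3 + 1 ≤ 2 ^ (n + 2) := by
    have : n < 2 ^ n := Nat.lt_two_pow_self
    rw [pow_add]
    omega
  have h4 : (directions (3 * n + 3)).card ≤ 2 ^ (4 * n + 9) := by
    refine h1.trans ?_
    calc 3 * ((3 * n + 3 + 1) * 2 ^ (3 * n + 3 + 2)) ≤ 4 * (2 ^ (n + 2) * 2 ^ (3 * n + 3 + 2)) := by
          gcongr; norm_num
      _ = 2 ^ (4 * n + 9) := by
          rw [show (4 : ℕ) = 2 ^ 2 by norm_num, ← pow_add, ← pow_add]; congr 1; ring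
  have h5 : 2 ^ (10 * n + 7) + 1 ≤ 2 ^ (10 * n + 8) := by
    have : 1 ≤ 2 ^ (10 * n + 7) := Nat.one_le_two_pow
    rw [pow_succ 2 (10 * n + 7)]
    omega
  rw [Finset.card_product]
  calc (2 ^ (10 * n + 7) + 1) * ((directions (3 * n + 3)).card *
        (Finset.Icc (-2 ^ (2 * n + 22) : ℤ) (2 ^ (2 * n + 22))).card)
      ≤ 2 ^ (10 * n + 8) * (2 ^ (4 * n + 9) * 2 ^ (2 * n + 24)) := by gcongr
    _ = 2 ^ (16 * n + 41) := by rw [← pow_add, ← pow_add]; congr 1; ring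

/-- Which of the at most four cells of level `i` meeting a small box around `o` contains `v`. -/
def cellCode (i : ℕ) (o : ℤ × ℤ) (R : ℤ) (v : ℤ × ℤ) : Bool × Bool :=
  (decide ((cell i v).1 = (cell i (o.1 - R, o.2 - R)).1),
    decide ((cell i v).2 = (cell i (o.1 - R, o.2 - R)).2))

theorem cell_eq_of_cellCode_eq {i : ℕ} {o v w : ℤ × ℤ} {R : ℤ} (hR : 2 * R < 2 ^ (6 * i))
    (hv : InBox o R v) (hw : InBox o R w) (h : cellCode i o R v = cellCode i o R w) :
    cell i v = cell i w := by
  have hpos : (0 : ℤ) < 2 ^ (6 * i) := by positivity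
  have aux : ∀ x c : ℤ, |x - c| ≤ R →
      x / 2 ^ (6 * i) = (c - R) / 2 ^ (6 * i) ∨ x / 2 ^ (6 * i) = (c - R) / 2 ^ (6 * i) + 1 := by
    intro x c hx
    rw [abs_le] at hx
    have h1 : (c - R) / 2 ^ (6 * i) ≤ x / 2 ^ (6 * i) :=
      Int.ediv_le_ediv hpos (by linarith [hx.1])
    have h2 : x / 2 ^ (6 * i) ≤ (c - R + 2 ^ (6 * i)) / 2 ^ (6 * i) :=
      Int.ediv_le_ediv hpos (by linarith [hx.2])
    rw [Int.add_ediv_of_dvd_right (dvd_refl _), Int.ediv_self hpos.ne'] at h2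
    omega
  have h1 := aux _ _ hv.1
  have h2 := aux _ _ hv.2
  have h3 := aux _ _ hw.1
  have h4 := aux _ _ hw.2
  rw [cellCode, cellCode, Prod.mk.injEq, decide_eq_decide, decide_eq_decide] at h
  simp only [cell, Prod.mk.injEq] at h ⊢
  constructor
  · have := h.1; omega
  · have := h.2; omega

/-- The points of a line of level `n` that are close to a line owning their cell of level `3 n + 4`,
provided that these far-level lines do not run almost parallel to it. -/
theorem card_near_far_le {n : ℕ} {ℓ : GridLine} (hℓ : ℓ ∈ family n)
    {o : ℤ × ℤ} {s : Finset (ℤ × ℤ)} (hs : ∀ v ∈ s, ℓ.Mem v)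
    (hbox : ∀ v ∈ s, InBox o (2 ^ (18 * n + 20)) v)
    (hnear : ∀ v ∈ s, ∃ ℓ', owner (3 * n + 4) v = some ℓ' ∧ ℓ'.Near n v ∧
      ℓ.height * ℓ'.height ≤ |det ℓ ℓ'| * 2 ^ (2 * n + 22)) :
    s.card ≤ 2 ^ (8 * n + 29) := by
  have : Nonempty GridLine := ⟨ℓ⟩
  choose! L hL hLnear hT using hnear
  have hpos : ∀ v ∈ s, 0 < (L v).height := fun v hv => by
    obtain ⟨j, h⟩ := exists_mem_family_of_owner (hL v hv)
    exact h.1.height_pos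
  have hdet : ∀ v ∈ s, det ℓ (L v) ≠ 0 := fun v hv h0 => by
    have h1 := hT v hv
    rw [h0, abs_zero, zero_mul] at h1
    exact (mul_pos hℓ.1.height_pos (hpos v hv)).not_ge h1
  have hfiber : ∀ κ ∈ (Finset.univ : Finset (Bool × Bool)),
      (s.filter fun v => cellCode (3 * n + 4) o (2 ^ (18 * n + 20)) v = κ).card
        ≤ 2 ^ (8 * n + 26) + 1 := by
    intro κ _
    refine card_le_of_progress hℓ.1.p_nonneg (fun v hv => hs v (Finset.mem_filter.1 hv).1) ?_
    intro u hu v hv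
    rw [Finset.mem_filter] at hu hv
    have hLL : L u = L v := by
      have hcell : cell (3 * n + 4) u = cell (3 * n + 4) v := by
        refine cell_eq_of_cellCode_eq ?_ (hbox u hu.1) (hbox v hv.1) (hu.2.trans hv.2.symm)
        rw [← pow_succ']
        exact pow_lt_pow_right₀ (by norm_num) (by omega)
      have := owner_congr hcell
      rw [hL u hu.1, hL v hv.1] at this
      exact Option.some.inj this
    have := progress_sub_le_of_near (hs u hu.1) (hs v hv.1) (hLL ▸ hLnear u hu.1)
      (hLnear v hv.1) (hdet v hv.1) (hT v hv.1)
    refine this.trans (le_of_eq ?_)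
    push_cast
    rw [show (16 : ℤ) = 2 ^ 4 by norm_num, ← pow_add, ← pow_add]
    congr 1
    ring
  refine (Finset.card_le_mul_card_image_of_maps_to (fun v _ => Finset.mem_univ _) _ hfiber).trans ?_
  have : 1 ≤ 2 ^ (8 * n + 26) := Nat.one_le_two_pow
  have e : 2 ^ (8 * n + 29) = 8 * 2 ^ (8 * n + 26) := by ring
  simp only [Finset.card_univ, Fintype.card_prod, Fintype.card_bool]
  omega

theorem card_central_le {n : ℕ} {ℓ : GridLine} (hp : 0 ≤ ℓ.p) {s : Finset (ℤ × ℤ)}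
    (hs : ∀ v ∈ s, ℓ.Mem v) (hc : ∀ v ∈ s, Central (cell n v)) : s.card ≤ 2 ^ (6 * n + 3) := by
  have hpos : (0 : ℤ) < 2 ^ (6 * n) := by positivity
  have aux : ∀ x : ℤ, -1 ≤ x / 2 ^ (6 * n) ∧ x / 2 ^ (6 * n) ≤ 0 → |x| ≤ 2 ^ (6 * n) := by
    rintro x ⟨h1, h2⟩
    rw [Int.le_ediv_iff_mul_le hpos] at h1
    have h2 := (Int.ediv_lt_iff_lt_mul hpos).1 (Int.lt_add_one_of_le h2)
    rw [abs_le]; constructor <;> linarith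
  have h : s.card ≤ 4 * 2 ^ (6 * n) + 1 := by
    refine card_le_of_progress hp hs fun u hu v hv => ?_
    have h1 := aux _ (hc u hu).1
    have h2 := aux _ (hc u hu).2
    have h3 := aux _ (hc v hv).1
    have h4 := aux _ (hc v hv).2
    have h5 := (le_abs_self _).trans (ℓ.abs_progress_sub_le u v)
    have h6 := abs_sub v.1 u.1
    have h7 := abs_sub v.2 u.2
    push_cast
    linarith
  have : 1 ≤ 2 ^ (6 * n) := Nat.one_le_two_pow
  have e : 2 ^ (6 * n + 3) = 8 * 2 ^ (6 * n) := by ring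
  omega

/-- No line owning a cell of level `3 n + 4` runs close to the part of `ℓ` in the box and almost
parallel to it. -/
def Unobstructed (n : ℕ) (o : ℤ × ℤ) (ℓ : GridLine) : Prop :=
  ∀ v, ℓ.Mem v → InBox o (2 ^ (18 * n + 20)) v → ∀ ℓ', owner (3 * n + 4) v = some ℓ' →
    ℓ'.Near n v → ℓ.height * ℓ'.height ≤ |det ℓ ℓ'| * 2 ^ (2 * n + 22)

/-- An unobstructed line of level `n` owns all but few of its points in the box. -/
theorem card_lost_le {n : ℕ} (hn : 1 ≤ n) {ℓ : GridLine} (hℓ : ℓ ∈ family n) {o : ℤ × ℤ}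
    (hfree : Unobstructed n o ℓ) {s : Finset (ℤ × ℤ)} (hs : ∀ v ∈ s, ℓ.Mem v)
    (hbox : ∀ v ∈ s, InBox o (2 ^ (18 * n + 20)) v) (hlost : ∀ v ∈ s, owner 0 v ≠ some ℓ) :
    s.card ≤ 2 ^ (16 * n + 43) := by
  classical
  set s₁ := s.filter fun v => Central (cell n v)
  set s₂ := s.filter fun v => ∃ ℓ', ℓ' ≠ ℓ ∧ ℓ'.Near n v ∧
    ∃ j, n ≤ j ∧ j < 3 * n + 4 ∧ ℓ' ∈ family j
  set s₃ := s.filter fun v => ∃ ℓ', owner (3 * n + 4) v = some ℓ' ∧ ℓ'.Near n v ∧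
    ℓ.height * ℓ'.height ≤ |det ℓ ℓ'| * 2 ^ (2 * n + 22)
  have hsub : s ⊆ s₁ ∪ s₂ ∪ s₃ := by
    intro v hv
    simp only [s₁, s₂, s₃, Finset.mem_union, Finset.mem_filter, hv, true_and]
    rcases owner_ne hℓ (hs v hv) (hlost v hv) (m := 3 * n + 4) (by omega) with
      h | ⟨ℓ', hne, hm, h | h⟩
    · exact .inl (.inl h)
    · exact .inl (.inr ⟨ℓ', hne, near_of_meets hm, h⟩)
    · exact .inr ⟨ℓ', h, near_of_meets hm, hfree v (hs v hv) (hbox v hv) ℓ' h (near_of_meets hm)⟩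
  have h1 : s₁.card ≤ 2 ^ (6 * n + 3) := card_central_le hℓ.1.p_nonneg
    (fun v hv => hs v (Finset.mem_filter.1 hv).1) fun v hv => (Finset.mem_filter.1 hv).2
  have h2 : s₂.card ≤ 2 ^ (16 * n + 41) := card_near_comparable_le hn hℓ
    (fun v hv => hs v (Finset.mem_filter.1 hv).1) (fun v hv => hbox v (Finset.mem_filter.1 hv).1)
    fun v hv => (Finset.mem_filter.1 hv).2
  have h3 : s₃.card ≤ 2 ^ (8 * n + 29) := card_near_far_le hℓ
    (fun v hv => hs v (Finset.mem_filter.1 hv).1) (fun v hv => hbox v (Finset.mem_filter.1 hv).1)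
    fun v hv => (Finset.mem_filter.1 hv).2
  have h4 := (Finset.card_le_card hsub).trans
    ((Finset.card_union_le _ _).trans (add_le_add_left (Finset.card_union_le _ _) _))
  have h5 : 2 ^ (6 * n + 3) ≤ 2 ^ (16 * n + 41) := Nat.pow_le_pow_right (by norm_num) (by omega)
  have h6 : 2 ^ (8 * n + 29) ≤ 2 ^ (16 * n + 41) := Nat.pow_le_pow_right (by norm_num) (by omega)
  have e : 2 ^ (16 * n + 43) = 4 * 2 ^ (16 * n + 41) := by ring
  omega

/-- Of five parallels at distances at least `2 ^ (16 n)`, one is unobstructed: only four cells of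
level `3 n + 4` meet the box, and an almost parallel line obstructs at most one of them. -/
theorem exists_unobstructed {n : ℕ} (hn : 1 ≤ n) (o : ℤ × ℤ) {p q c₀ : ℤ}
    (hpos : 0 < (⟨p, q, c₀⟩ : GridLine).height) :
    ∃ j : Fin 5, Unobstructed n o
      ⟨p, q, c₀ + 2 ^ (16 * n) * (⟨p, q, c₀⟩ : GridLine).height * (j : ℕ)⟩ := by
  by_contra! hcon
  set M := (⟨p, q, c₀⟩ : GridLine).height
  have hht : ∀ c, (⟨p, q, c⟩ : GridLine).height = M := fun c => rfl
  simp only [Unobstructed, hht] at hcon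
  push Not at hcon
  choose v hv hbox L hL hnear hlt using hcon
  obtain ⟨i, j, hij, hcode⟩ := Fintype.exists_ne_map_eq_of_card_lt
    (fun i : Fin 5 => cellCode (3 * n + 4) o (2 ^ (18 * n + 20)) (v i)) (by simp)
  have hLL : L i = L j := by
    have hcell : cell (3 * n + 4) (v i) = cell (3 * n + 4) (v j) := by
      refine cell_eq_of_cellCode_eq ?_ (hbox i) (hbox j) hcode
      rw [← pow_succ']
      exact pow_lt_pow_right₀ (by norm_num) (by omega)
    have := owner_congr hcell
    rw [hL i, hL j] at this
    exact Option.some.inj this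
  set B := L j with hB
  have hBpos : 0 < B.height := by
    obtain ⟨k, h⟩ := exists_mem_family_of_owner (hL j)
    exact h.1.height_pos
  have hβ := Near.abs_sub_le (hLL ▸ hnear i) (hnear j)
  have hdet : |B.p * q - p * B.q| * 2 ^ (2 * n + 22) < M * B.height := hlt j
  have hR : ∀ k : Fin 5, |(v k).1 - o.1| ≤ 2 ^ (18 * n + 20) ∧ |(v k).2 - o.2| ≤ 2 ^ (18 * n + 20) :=
    hbox
  have hx : |(v j).1 - (v i).1| ≤ 2 * 2 ^ (18 * n + 20) := by
    have h1 := abs_le.1 (hR i).1; have h2 := abs_le.1 (hR j).1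
    rw [abs_le]; constructor <;> linarith
  have hy : |(v j).2 - (v i).2| ≤ 2 * 2 ^ (18 * n + 20) := by
    have h1 := abs_le.1 (hR i).2; have h2 := abs_le.1 (hR j).2
    rw [abs_le]; constructor <;> linarith
  set x := (v j).1 - (v i).1
  set y := (v j).2 - (v i).2
  set α := q * x - p * y with hα
  have hpM : |p| ≤ M := le_max_left _ _
  have hqM : |q| ≤ M := le_max_right _ _
  -- `B` is almost parallel to `(p, q)`, so a displacement along `B` hardly changes `q x - p y`.
  have hαB : B.height * |α| ≤ M * (6 * 2 ^ (6 * n) * B.height)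
      + |B.p * q - p * B.q| * (2 * 2 ^ (18 * n + 20)) := by
    have e1 : B.q * α = q * (B.q * x - B.p * y) + (B.p * q - p * B.q) * y := by rw [hα]; ring
    have e2 : B.p * α = p * (B.q * x - B.p * y) + (B.p * q - p * B.q) * x := by rw [hα]; ring
    rcases max_choice |B.p| |B.q| with hm | hm
    · rw [show B.height * |α| = |B.p * α| by rw [abs_mul, ← hm]; rfl, e2]
      refine (abs_add_le _ _).trans (add_le_add ?_ ?_) <;> rw [abs_mul]
      · exact mul_le_mul hpM hβ (abs_nonneg _) ((abs_nonneg _).trans hpM)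
      · exact mul_le_mul_of_nonneg_left hx (abs_nonneg _)
    · rw [show B.height * |α| = |B.q * α| by rw [abs_mul, ← hm]; rfl, e1]
      refine (abs_add_le _ _).trans (add_le_add ?_ ?_) <;> rw [abs_mul]
      · exact mul_le_mul hqM hβ (abs_nonneg _) ((abs_nonneg _).trans hpM)
      · exact mul_le_mul_of_nonneg_left hy (abs_nonneg _)
  have e3 : 2 * (2 : ℤ) ^ (18 * n + 20) = 2 ^ (2 * n + 22) * (2 ^ (16 * n - 1)) := by
    rw [← pow_succ', ← pow_add]; congr 1; omega
  have hs2 : (2 : ℤ) ^ (16 * n) = 2 * 2 ^ (16 * n - 1) := by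
    rw [← pow_succ']; congr 1; omega
  have hα' : |α| < M * (6 * 2 ^ (6 * n) + 2 ^ (16 * n - 1)) := by
    refine lt_of_mul_lt_mul_left (hαB.trans_lt ?_) hBpos.le
    rw [e3]
    have := mul_lt_mul_of_pos_right hdet (show (0 : ℤ) < 2 ^ (16 * n - 1) by positivity)
    linarith
  have hvi := (hv i).abs_val_le
  have hvj := (hv j).abs_val_le
  rw [hht] at hvi hvj
  simp only [val] at hvi hvj
  have hdiff : 2 ^ (16 * n) * M ≤ 2 ^ (16 * n) * M * |((j : ℕ) : ℤ) - (i : ℕ)| := by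
    refine le_mul_of_one_le_right (by positivity) (Int.one_le_abs ?_)
    intro h
    exact hij (Fin.ext (by omega))
  have hsum : 2 ^ (16 * n) * M * |((j : ℕ) : ℤ) - (i : ℕ)| ≤ |α| + M + M := by
    have e : 2 ^ (16 * n) * M * (((j : ℕ) : ℤ) - (i : ℕ)) = α
        - (q * (v j).1 - p * (v j).2 - (c₀ + 2 ^ (16 * n) * M * (j : ℕ)))
        + (q * (v i).1 - p * (v i).2 - (c₀ + 2 ^ (16 * n) * M * (i : ℕ))) := by
      rw [hα]; ring
    rw [show 2 ^ (16 * n) * M * |((j : ℕ) : ℤ) - (i : ℕ)|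
      = |2 ^ (16 * n) * M * (((j : ℕ) : ℤ) - (i : ℕ))| by
        rw [abs_mul, abs_of_pos (show 0 < 2 ^ (16 * n) * M by positivity)], e]
    exact (abs_add_le _ _).trans (add_le_add ((abs_sub _ _).trans (add_le_add le_rfl hvj)) hvi)
  have hbig : 2 ^ 9 * 2 ^ (6 * n) ≤ (2 : ℤ) ^ (16 * n - 1) := by
    rw [← pow_add]
    exact pow_le_pow_right₀ (by norm_num) (by omega)
  have h1 : (1 : ℤ) ≤ 2 ^ (6 * n) := one_le_pow₀ (by norm_num)
  rw [hs2] at hdiff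
  rw [hs2] at hsum
  nlinarith [mul_le_mul_of_nonneg_left hbig hpos.le, mul_le_mul_of_nonneg_left h1 hpos.le]

/-! ### The weights and the lower bound -/

/-- The position of a grid point in the modified drawing of the grid: points owned by a line are
moved onto that line. -/
noncomputable def position (v : ℤ × ℤ) : EuclideanSpace ℝ (Fin 2) :=
  match owner 0 v with
  | none => toPlane v
  | some ℓ => ℓ.foot v

open Classical in
/-- The surcharge for an edge that does not follow a line owning both its ends. -/
noncomputable def surcharge (u v : ℤ × ℤ) : ℝ≥0 :=
  if owner 0 u = owner 0 v ∧ owner 0 u ≠ none then 0 else 1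

theorem surcharge_comm (u v : ℤ × ℤ) : surcharge u v = surcharge v u := by
  unfold surcharge
  congr 1
  exact propext ⟨fun h => ⟨h.1.symm, h.1 ▸ h.2⟩, fun h => ⟨h.1.symm, h.1 ▸ h.2⟩⟩

/-- The edge weights: the length of the edge in the modified drawing, plus the surcharge. -/
noncomputable def weight : Grid.edgeSet → ℝ≥0 := fun e =>
  Sym2.lift ⟨fun u v => ‖position u - position v‖₊ + surcharge u v, fun u v => by
    simp only [surcharge_comm u v, ← nnnorm_neg (position u - position v), neg_sub]⟩ e.1

theorem weight_mk {u v : ℤ × ℤ} (h : Grid.Adj u v) :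
    (weight ⟨s(u, v), Grid.mem_edgeSet.2 h⟩ : ℝ) = ‖position u - position v‖ + surcharge u v := by
  simp [weight]

theorem position_of_owner {v : ℤ × ℤ} {ℓ : GridLine} (h : owner 0 v = some ℓ) :
    position v = ℓ.foot v := by simp only [position, h]

theorem height_pos_of_owner {v : ℤ × ℤ} {ℓ : GridLine} (h : owner 0 v = some ℓ) :
    0 < ℓ.height := by
  obtain ⟨j, h⟩ := exists_mem_family_of_owner h
  exact h.1.height_pos

theorem norm_position_sub_le (v : ℤ × ℤ) : ‖position v - toPlane v‖ ≤ 3 / 4 := by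
  rcases h : owner 0 v with _ | ℓ
  · simp only [position, h, sub_self, norm_zero]; norm_num
  · rw [position_of_owner h]
    exact (mem_of_owner h).norm_foot_sub_le (height_pos_of_owner h)

theorem toPlane_sub_le_position (u v : ℤ × ℤ) :
    ‖toPlane u - toPlane v‖ ≤ ‖position u - position v‖ + 3 / 2 := by
  have h1 := norm_position_sub_le u
  have h2 := norm_position_sub_le v
  have e : toPlane u - toPlane v
      = (position u - position v) - (position u - toPlane u) + (position v - toPlane v) := by abel
  rw [e]
  refine (norm_add_le _ _).trans ?_
  have := norm_sub_le (position u - position v) (position u - toPlane u)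
  linarith

theorem position_sub_le_toPlane (u v : ℤ × ℤ) :
    ‖position u - position v‖ ≤ ‖toPlane u - toPlane v‖ + 3 / 2 := by
  have h1 := norm_position_sub_le u
  have h2 := norm_position_sub_le v
  have e : position u - position v
      = (toPlane u - toPlane v) + (position u - toPlane u) - (position v - toPlane v) := by abel
  rw [e]
  refine (norm_sub_le _ _).trans ?_
  have := norm_add_le (toPlane u - toPlane v) (position u - toPlane u)
  linarith

theorem toPlane_sub_norm_le (u v : ℤ × ℤ) :
    ‖toPlane u - toPlane v‖ ≤ ((|u.1 - v.1| + |u.2 - v.2| : ℤ) : ℝ) := by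
  rw [toPlane_sub_norm]
  push_cast
  apply Real.sqrt_le_iff.2
  refine ⟨by positivity, ?_⟩
  nlinarith [sq_abs ((u.1 : ℝ) - v.1), sq_abs ((u.2 : ℝ) - v.2),
    mul_nonneg (abs_nonneg ((u.1 : ℝ) - v.1)) (abs_nonneg ((u.2 : ℝ) - v.2))]

theorem toPlane_sub_norm_of_adj {u v : ℤ × ℤ} (h : Grid.Adj u v) :
    ‖toPlane u - toPlane v‖ ≤ 1 := by
  refine (toPlane_sub_norm_le u v).trans ?_
  have h : |u.1 - v.1| + |u.2 - v.2| = 1 := h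
  rw [h]
  simp

theorem weight_mk_le {u v : ℤ × ℤ} (h : Grid.Adj u v) :
    (weight ⟨s(u, v), Grid.mem_edgeSet.2 h⟩ : ℝ) ≤ 4 := by
  rw [weight_mk h]
  have h1 := position_sub_le_toPlane u v
  have h2 := toPlane_sub_norm_of_adj h
  have h3 : (surcharge u v : ℝ) ≤ 1 := by unfold surcharge; split_ifs <;> simp
  linarith

theorem weight_le (e : Grid.edgeSet) : (weight e : ℝ) ≤ 4 := by
  obtain ⟨e, he⟩ := e
  induction e using Sym2.ind with
  | _ u v => exact weight_mk_le (Grid.mem_edgeSet.1 he)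

/-- A walk either stays on points with one owner or pays the surcharge at least once. -/
theorem walkWeight_ge {u v : ℤ × ℤ} (p : Grid.Walk u v) :
    (‖position u - position v‖ ≤ walkWeight weight p ∧
      (u = v ∨ (owner 0 u = owner 0 v ∧ owner 0 u ≠ none))) ∨
    ‖position u - position v‖ + 1 ≤ walkWeight weight p := by
  induction p with
  | nil => left; simp
  | @cons a b c h p ih =>
    have htri := norm_sub_le_norm_sub_add_norm_sub (position a) (position b) (position c)
    rw [walkWeight, NNReal.coe_add, weight_mk h]
    by_cases hs : owner 0 a = owner 0 b ∧ owner 0 a ≠ none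
    · have e : (surcharge a b : ℝ) = 0 := by rw [surcharge, if_pos hs]; simp
      rw [e]
      rcases ih with ⟨h1, h2⟩ | h1
      · left
        refine ⟨by linarith, .inr ?_⟩
        rcases h2 with rfl | h2
        · exact hs
        · exact ⟨hs.1.trans h2.1, hs.2⟩
      · right; linarith
    · have e : (surcharge a b : ℝ) = 1 := by rw [surcharge, if_neg hs]; simp
      rw [e]
      right
      rcases ih with ⟨h1, -⟩ | h1 <;> linarith

theorem le_gridDist_weight (u v : ℤ × ℤ) :
    ‖toPlane u - toPlane v‖ - 1 ≤ gridDist weight u v := by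
  have : Nonempty (Grid.Walk u v) := grid_preconnected u v
  refine le_ciInf fun p => ?_
  have hnn : (0 : ℝ) ≤ walkWeight weight p := NNReal.coe_nonneg _
  rcases walkWeight_ge p with ⟨h1, rfl | ⟨h2, h3⟩⟩ | h1
  · simp only [sub_self, norm_zero]; linarith
  · obtain ⟨ℓ, hℓ⟩ := Option.ne_none_iff_exists'.1 h3
    have hℓ' := h2 ▸ hℓ
    have := (mem_of_owner hℓ).norm_sub_le (height_pos_of_owner hℓ) (mem_of_owner hℓ')
    rw [position_of_owner hℓ, position_of_owner hℓ'] at h1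
    linarith
  · have := toPlane_sub_le_position u v
    linarith

/-! ### Travelling along a line -/

namespace GridLine

variable {ℓ : GridLine} {u v w : ℤ × ℤ}

theorem Mem.dot_le (hp : 0 ≤ ℓ.p) (hu : ℓ.Mem u) (hv : ℓ.Mem v)
    (h : ℓ.progress u ≤ ℓ.progress v) :
    ℓ.p * u.1 + ℓ.q * u.2 ≤ ℓ.p * v.1 + ℓ.q * v.2 := by
  obtain ⟨h1, h2⟩ := hu.monotone hp hv h
  unfold slopeSign at h2
  split_ifs at h2 with hq
  · nlinarith [mul_le_mul_of_nonneg_left h1 hp]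
  · nlinarith [mul_le_mul_of_nonneg_left h1 hp]

/-- The coordinate along the line. -/
noncomputable def along (ℓ : GridLine) (v : ℤ × ℤ) : ℝ :=
  ((ℓ.p * v.1 + ℓ.q * v.2 : ℤ) : ℝ) / √ℓ.normSq

theorem Mem.along_le (hp : 0 ≤ ℓ.p) (hu : ℓ.Mem u) (hv : ℓ.Mem v)
    (h : ℓ.progress u ≤ ℓ.progress v) : ℓ.along u ≤ ℓ.along v := by
  unfold along
  exact div_le_div_of_nonneg_right (by exact_mod_cast hu.dot_le hp hv h) (Real.sqrt_nonneg _)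

theorem norm_foot_sub_foot_eq_abs (hpos : 0 < ℓ.height) (u v : ℤ × ℤ) :
    ‖ℓ.foot u - ℓ.foot v‖ = |ℓ.along u - ℓ.along v| := by
  rw [norm_foot_sub_foot hpos, along, along, ← sub_div, abs_div, abs_of_nonneg (Real.sqrt_nonneg _)]
  congr 2
  push_cast
  ring

theorem along_sub_le (hpos : 0 < ℓ.height) (u v : ℤ × ℤ) :
    ℓ.along u - ℓ.along v ≤ ‖toPlane u - toPlane v‖ := by
  have hN := normSq_pos hpos
  refine (le_abs_self _).trans ?_
  rw [← norm_foot_sub_foot_eq_abs hpos, norm_foot_sub_foot hpos, div_le_iff₀ (Real.sqrt_pos.2 hN),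
    toPlane_sub_norm, ← Real.sqrt_mul (by positivity), ← Real.sqrt_sq_eq_abs]
  apply Real.sqrt_le_sqrt
  unfold normSq
  push_cast
  nlinarith [sq_nonneg ((ℓ.q : ℝ) * (u.1 - v.1) - ℓ.p * (u.2 - v.2))]

theorem Mem.inBox_between (hp : 0 ≤ ℓ.p) (hu : ℓ.Mem u) (hv : ℓ.Mem v) (hw : ℓ.Mem w)
    (h : ℓ.progress u ≤ ℓ.progress v) (h' : ℓ.progress v ≤ ℓ.progress w) {o : ℤ × ℤ} {R : ℤ}
    (bu : InBox o R u) (bw : InBox o R w) : InBox o R v := by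
  have h1 := hu.monotone hp hv h
  have h2 := hv.monotone hp hw h'
  unfold InBox at *
  simp only [abs_le] at *
  rcases ℓ.slopeSign_eq with e | e <;> rw [e] at h1 h2 <;> omega

/-- Following a line costs the Euclidean length, plus a constant for each point on the way that
the line has lost to another one. -/
theorem walkWithin_along (hp : 0 ≤ ℓ.p) (hpos : 0 < ℓ.height) (hu : ℓ.Mem u) (hw : ℓ.Mem w)
    {o : ℤ × ℤ} {R : ℤ} (bu : InBox o R u) (bw : InBox o R w) {B : ℕ}
    (hB : ∀ s : Finset (ℤ × ℤ), (∀ v ∈ s, ℓ.Mem v) → (∀ v ∈ s, InBox o R v) →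
      (∀ v ∈ s, owner 0 v ≠ some ℓ) → s.card ≤ B) :
    WalkWithin weight u w (‖toPlane u - toPlane w‖ + 8 * B) := by
  classical
  wlog h : ℓ.progress u ≤ ℓ.progress w generalizing u w
  · rw [norm_sub_rev]
    exact (this hw hu bw bu (not_le.1 h).le).symm
  obtain ⟨K, γ, rfl, rfl, hmem, hadj, hprog⟩ := hu.exists_seq hp hw h
  let b : ℕ → ℝ := fun k => if owner 0 (γ k) = some ℓ then 0 else 1
  have hb : ∀ k, 0 ≤ b k := fun k => by simp only [b]; split_ifs <;> norm_num
  have hstep : ∀ k < K, WalkWithin weight (γ k) (γ (k + 1))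
      ((ℓ.along (γ (k + 1)) - ℓ.along (γ k)) + 4 * (b k + b (k + 1))) := by
    intro k _
    refine (WalkWithin.of_adj (hadj k)).mono ?_
    have hmono := (hmem k).along_le hp (hmem (k + 1))
      (by rw [hprog k, hprog (k + 1)]; push_cast; omega)
    by_cases hgood : owner 0 (γ k) = some ℓ ∧ owner 0 (γ (k + 1)) = some ℓ
    · rw [weight_mk (hadj k), position_of_owner hgood.1, position_of_owner hgood.2, surcharge,
        if_pos ⟨by rw [hgood.1, hgood.2], by simp [hgood.1]⟩, norm_foot_sub_foot_eq_abs hpos,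
        abs_sub_comm, abs_of_nonneg (by linarith)]
      have := hb k; have := hb (k + 1)
      push_cast
      linarith
    · have h1 : 1 ≤ b k + b (k + 1) := by
        rw [not_and_or] at hgood
        rcases hgood with hg | hg
        · have : b k = 1 := if_neg hg
          have := hb (k + 1); linarith
        · have : b (k + 1) = 1 := if_neg hg
          have := hb k; linarith
      have := weight_mk_le (hadj k)
      linarith
  refine (WalkWithin.of_seq γ _ K hstep).mono ?_
  rw [Finset.sum_add_distrib, Finset.sum_range_sub (fun k => ℓ.along (γ k)), ← Finset.mul_sum,
    Finset.sum_add_distrib]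
  have h1 : ∑ k ∈ Finset.range K, b k ≤ ∑ k ∈ Finset.range (K + 1), b k := by
    rw [Finset.sum_range_succ]; linarith [hb K]
  have h2 : ∑ k ∈ Finset.range K, b (k + 1) ≤ ∑ k ∈ Finset.range (K + 1), b k := by
    rw [Finset.sum_range_succ' b]; linarith [hb 0]
  have h3 : ∑ k ∈ Finset.range (K + 1), b k ≤ B := by
    have e : ∑ k ∈ Finset.range (K + 1), b k
        = (((Finset.range (K + 1)).filter fun k => owner 0 (γ k) ≠ some ℓ).card : ℝ) := by
      rw [Finset.card_filter]
      push_cast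
      refine Finset.sum_congr rfl fun k _ => ?_
      by_cases hk : owner 0 (γ k) = some ℓ <;> simp [b, hk]
    rw [e, Nat.cast_le, ← Finset.card_image_of_injective _ (f := γ) (fun i j hij => by
      have hi := hprog i
      rw [hij, hprog j] at hi
      omega)]
    apply hB
    · intro v hv
      obtain ⟨k, -, rfl⟩ := Finset.mem_image.1 hv
      exact hmem k
    · intro v hv
      obtain ⟨k, hk, rfl⟩ := Finset.mem_image.1 hv
      have hk := Finset.mem_range.1 (Finset.mem_filter.1 hk).1
      refine hu.inBox_between hp (hmem k) hw ?_ ?_ bu bw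
      · rw [hprog k]; omega
      · rw [hprog k, hprog K]; omega
    · intro v hv
      obtain ⟨k, hk, rfl⟩ := Finset.mem_image.1 hv
      exact (Finset.mem_filter.1 hk).2
  have h4 := along_sub_le hpos (γ K) (γ 0)
  rw [norm_sub_rev] at h4
  linarith

theorem exists_centered_rem {a : ℤ} (ha : a ≠ 0) (z : ℤ) :
    ∃ k, -|a| < 2 * (z + a * k) ∧ 2 * (z + a * k) ≤ |a| := by
  have hpos := abs_pos.2 ha
  have h1 := Int.mul_ediv_add_emod z |a|
  have h2 := Int.emod_nonneg z hpos.ne'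
  have h3 := Int.emod_lt_of_pos z hpos
  obtain ⟨t, ht1, ht2⟩ : ∃ t, -|a| < 2 * (z + |a| * t) ∧ 2 * (z + |a| * t) ≤ |a| := by
    by_cases h : 2 * (z % |a|) ≤ |a|
    · exact ⟨-(z / |a|), by linarith, by linarith⟩
    · exact ⟨-(z / |a|) - 1, by linarith, by linarith⟩
  rcases abs_choice a with e | e
  · exact ⟨t, by rw [e] at ht1 ht2 ⊢; exact ⟨ht1, ht2⟩⟩
  · refine ⟨-t, ?_⟩
    rw [e] at ht1 ht2 ⊢
    constructor <;> linarith

/-- A point not far from a line can be moved to the digital line by a short displacement parallel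
to a coordinate axis. -/
theorem exists_mem_near (hpos : 0 < ℓ.height) {T : ℤ} (hT : |ℓ.val u| ≤ T * ℓ.height) :
    ∃ v, ℓ.Mem v ∧ |u.1 - v.1| + |u.2 - v.2| ≤ T + 1 := by
  have key : ∀ a : ℤ, a ≠ 0 → ℓ.height = |a| →
      ∃ k, -|a| < 2 * (ℓ.val u + a * k) ∧ 2 * (ℓ.val u + a * k) ≤ |a| ∧ |k| ≤ T + 1 := by
    intro a ha hM
    obtain ⟨k, h1, h2⟩ := exists_centered_rem ha (ℓ.val u)
    refine ⟨k, h1, h2, ?_⟩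
    rw [hM] at hT
    have hak : |a| * |k| ≤ |a| * (T + 1) := by
      rw [← abs_mul, abs_le]
      rw [abs_le] at hT
      have := abs_nonneg a
      constructor <;> linarith [hT.1, hT.2]
    exact le_of_mul_le_mul_left hak (abs_pos.2 ha)
  have hq0 := abs_nonneg ℓ.q
  have hp0 := abs_nonneg ℓ.p
  rcases max_choice |ℓ.p| |ℓ.q| with hm | hm
  · have hM : ℓ.height = |ℓ.p| := hm
    have hp : ℓ.p ≠ 0 := fun h => by rw [hM, h] at hpos; simp at hpos
    obtain ⟨k, h1, h2, h3⟩ := key ℓ.p hp hM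
    refine ⟨(u.1, u.2 - k), ?_, by simpa using h3⟩
    have e : ℓ.val (u.1, u.2 - k) = ℓ.val u + ℓ.p * k := by simp only [val]; ring
    rw [Mem, e]
    constructor <;> linarith
  · have hM : ℓ.height = |ℓ.q| := hm
    have hq : ℓ.q ≠ 0 := fun h => by rw [hM, h] at hpos; simp at hpos
    obtain ⟨k, h1, h2, h3⟩ := key ℓ.q hq hM
    refine ⟨(u.1 + k, u.2), ?_, by simpa using h3⟩
    have e : ℓ.val (u.1 + k, u.2) = ℓ.val u + ℓ.q * k := by simp only [val]; ring
    rw [Mem, e]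
    constructor <;> linarith

end GridLine

/-- A displacement almost in a direction of level `n` is realized along one of five parallels of
level `n` next to `u`; both ends are connected to it by short detours. -/
theorem walkWithin_of_normalized {n : ℕ} {p q : ℤ} (hnorm : (⟨p, q, 0⟩ : GridLine).Normalized)
    (hdvd : (⟨p, q, 0⟩ : GridLine).height ∣ 2 ^ n) {u w : ℤ × ℤ}
    (hdir : |q * (w.1 - u.1) - p * (w.2 - u.2)| ≤ 2 * (⟨p, q, 0⟩ : GridLine).height)
    (hbox : InBox u (2 ^ (18 * n + 19)) w) :
    WalkWithin weight u w (‖toPlane u - toPlane w‖ + 2 ^ 47 * 2 ^ (16 * n)) := by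
  -- At level `0` the distances are bounded, and the constant absorbs any walk.
  rcases Nat.eq_zero_or_pos n with rfl | hn
  · refine (WalkWithin.of_edge_le weight_le u w).mono ?_
    have h1 : |u.1 - w.1| + |u.2 - w.2| ≤ 2 ^ 20 := by
      have := hbox.1; have := hbox.2
      rw [abs_sub_comm u.1, abs_sub_comm u.2]
      norm_num at *
      linarith
    have h2 : ((|u.1 - w.1| + |u.2 - w.2| : ℤ) : ℝ) ≤ 2 ^ 20 := by exact_mod_cast h1
    have := norm_nonneg (toPlane u - toPlane w)
    norm_num
    norm_num at h2
    linarith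
  set M := (⟨p, q, 0⟩ : GridLine).height with hM
  have hMpos : 0 < M := hnorm.height_pos
  have hspos : (0 : ℤ) < 2 ^ (16 * n) := by positivity
  have hsM : 0 < 2 ^ (16 * n) * M := mul_pos hspos hMpos
  set k₀ := (q * u.1 - p * u.2) / (2 ^ (16 * n) * M) with hk₀
  obtain ⟨j, hfree⟩ := exists_unobstructed hn u (p := p) (q := q) (c₀ := 2 ^ (16 * n) * M * k₀)
    hMpos
  set ℓ : GridLine := ⟨p, q, 2 ^ (16 * n) * M * k₀ + 2 ^ (16 * n) * M * (j : ℕ)⟩ with hℓ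
  have hfree : Unobstructed n u ℓ := hfree
  have hℓnorm : ℓ.Normalized := ⟨hnorm.coprime, hnorm.sign⟩
  have hheight : ℓ.height = M := rfl
  have hfam : ℓ ∈ family n := by
    refine ⟨hℓnorm, hdvd, ?_⟩
    exact dvd_add (Dvd.intro _ rfl) (Dvd.intro _ rfl)
  have h1 := Int.mul_ediv_add_emod (q * u.1 - p * u.2) (2 ^ (16 * n) * M)
  have h2 := Int.emod_nonneg (q * u.1 - p * u.2) hsM.ne'
  have h3 := Int.emod_lt_of_pos (q * u.1 - p * u.2) hsM
  rw [← hk₀] at h1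
  have hj : 2 ^ (16 * n) * M * ((j : ℕ) : ℤ) ≤ 2 ^ (16 * n) * M * 4 :=
    mul_le_mul_of_nonneg_left (by have := j.2; omega) hsM.le
  have hj0 : 0 ≤ 2 ^ (16 * n) * M * ((j : ℕ) : ℤ) := by positivity
  have hsM1 : M ≤ 2 ^ (16 * n) * M := le_mul_of_one_le_left hMpos.le (by omega)
  have hvu : |ℓ.val u| ≤ 5 * (2 ^ (16 * n) * M) := by
    have e : ℓ.val u = q * u.1 - p * u.2
        - (2 ^ (16 * n) * M * k₀ + 2 ^ (16 * n) * M * (j : ℕ)) := rfl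
    rw [e, abs_le]
    constructor <;> linarith
  have hvw : |ℓ.val w| ≤ 7 * (2 ^ (16 * n) * M) := by
    have e : ℓ.val w = (q * (w.1 - u.1) - p * (w.2 - u.2)) + ℓ.val u := by
      simp only [val, hℓ]; ring
    rw [e]
    refine (abs_add_le _ _).trans ?_
    linarith
  obtain ⟨u', hu', hdu⟩ := exists_mem_near (ℓ := ℓ) (u := u) (T := 7 * 2 ^ (16 * n))
    (by rw [hheight]; exact hMpos) (by rw [hheight]; linarith)
  obtain ⟨w', hw', hdw⟩ := exists_mem_near (ℓ := ℓ) (u := w) (T := 7 * 2 ^ (16 * n))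
    (by rw [hheight]; exact hMpos) (by rw [hheight]; linarith)
  have hdu : |u.1 - u'.1| + |u.2 - u'.2| ≤ 8 * 2 ^ (16 * n) := by linarith
  have hdw : |w.1 - w'.1| + |w.2 - w'.2| ≤ 8 * 2 ^ (16 * n) := by linarith
  have e20 : (2 : ℤ) ^ (18 * n + 20) = 2 * 2 ^ (18 * n + 19) := by ring
  have e19 : 8 * (2 : ℤ) ^ (16 * n) ≤ 2 ^ (18 * n + 19) := by
    rw [show (8 : ℤ) = 2 ^ 3 by norm_num, ← pow_add]
    exact pow_le_pow_right₀ (by norm_num) (by omega)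
  have bu : InBox u (2 ^ (18 * n + 20)) u' := by
    have := abs_nonneg (u.1 - u'.1); have := abs_nonneg (u.2 - u'.2)
    constructor <;> rw [abs_sub_comm] <;> linarith
  have bw : InBox u (2 ^ (18 * n + 20)) w' := by
    have := abs_nonneg (w.1 - w'.1); have := abs_nonneg (w.2 - w'.2)
    constructor
    · have := abs_sub_le w'.1 w.1 u.1
      rw [abs_sub_comm w'.1 w.1] at this
      linarith [hbox.1]
    · have := abs_sub_le w'.2 w.2 u.2
      rw [abs_sub_comm w'.2 w.2] at this
      linarith [hbox.2]
  have hmid := walkWithin_along hℓnorm.p_nonneg (by rw [hheight]; exact hMpos) hu' hw' bu bw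
    fun s h1 h2 h3 => card_lost_le hn hfam hfree h1 h2 h3
  have hpre := WalkWithin.of_edge_le weight_le u u'
  have hpost := (WalkWithin.of_edge_le weight_le w w').symm
  refine ((hpre.trans hmid).trans hpost).mono ?_
  have n1 := toPlane_sub_norm_le u u'
  have n2 := toPlane_sub_norm_le w w'
  have hduR : ((|u.1 - u'.1| + |u.2 - u'.2| : ℤ) : ℝ) ≤ 8 * 2 ^ (16 * n) := by exact_mod_cast hdu
  have hdwR : ((|w.1 - w'.1| + |w.2 - w'.2| : ℤ) : ℝ) ≤ 8 * 2 ^ (16 * n) := by exact_mod_cast hdw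
  have n3 : ‖toPlane u' - toPlane w'‖ ≤ ‖toPlane u - toPlane w‖
      + ‖toPlane u - toPlane u'‖ + ‖toPlane w - toPlane w'‖ := by
    have e : toPlane u' - toPlane w' = (toPlane u - toPlane w) - (toPlane u - toPlane u')
        + (toPlane w - toPlane w') := by abel
    rw [e]
    refine (norm_add_le _ _).trans ?_
    have := norm_sub_le (toPlane u - toPlane w) (toPlane u - toPlane u')
    linarith
  have e43 : (((2 : ℕ) ^ (16 * n + 43) : ℕ) : ℝ) = 2 ^ 43 * 2 ^ (16 * n) := by
    push_cast; ring
  rw [e43]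
  have hs1 : (0 : ℝ) < 2 ^ (16 * n) := by positivity
  norm_num
  norm_num at hduR hdwR n1 n2
  linarith

theorem exists_normalized {a b : ℤ} (h : a ≠ 0 ∨ b ≠ 0) :
    ∃ g p q : ℤ, g ≠ 0 ∧ a = g * p ∧ b = g * q ∧ (⟨p, q, 0⟩ : GridLine).Normalized := by
  have hg : Int.gcd a b ≠ 0 := by
    rw [Ne, Int.gcd_eq_zero_iff]
    tauto
  obtain ⟨p, hp⟩ := Int.gcd_dvd_left a b
  obtain ⟨q, hq⟩ := Int.gcd_dvd_right a b
  have hg' : ((Int.gcd a b : ℕ) : ℤ) ≠ 0 := by exact_mod_cast hg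
  set g : ℤ := ((Int.gcd a b : ℕ) : ℤ)
  have hco : IsCoprime p q := by
    refine ⟨Int.gcdA a b, Int.gcdB a b, mul_left_cancel₀ hg' ?_⟩
    have h1 : g = a * Int.gcdA a b + b * Int.gcdB a b := Int.gcd_eq_gcd_ab a b
    calc g * (Int.gcdA a b * p + Int.gcdB a b * q)
        = (g * p) * Int.gcdA a b + (g * q) * Int.gcdB a b := by ring
      _ = g * 1 := by rw [← hp, ← hq, ← h1, mul_one]
  rcases lt_trichotomy p 0 with h0 | rfl | h0
  · exact ⟨-g, -p, -q, neg_ne_zero.2 hg', by linarith, by linarith,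
      hco.neg_left.neg_right, .inl (by simpa using h0)⟩
  · rcases Int.isUnit_iff.1 (isCoprime_zero_left.1 hco) with rfl | rfl
    · exact ⟨g, 0, 1, hg', hp, hq, hco, .inr ⟨rfl, rfl⟩⟩
    · exact ⟨-g, 0, 1, neg_ne_zero.2 hg', by linarith, by linarith,
        isCoprime_zero_left.2 isUnit_one, .inr ⟨rfl, rfl⟩⟩
  · exact ⟨g, p, q, hg', hp, hq, hco, .inl h0⟩

/-- The same for directions that need not be primitive. -/
theorem walkWithin_of_direction {n : ℕ} {a b : ℤ} (hab : max |a| |b| = 2 ^ n) {u w : ℤ × ℤ}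
    (hdir : |b * (w.1 - u.1) - a * (w.2 - u.2)| ≤ 2 * 2 ^ n)
    (hbox : InBox u (2 ^ (18 * n + 19)) w) :
    WalkWithin weight u w (‖toPlane u - toPlane w‖ + 2 ^ 47 * 2 ^ (16 * n)) := by
  have h0 : a ≠ 0 ∨ b ≠ 0 := by
    by_contra! h
    rw [h.1, h.2] at hab
    have : (0 : ℤ) < 2 ^ n := by positivity
    simp at hab
    omega
  obtain ⟨g, p, q, hg, rfl, rfl, hnorm⟩ := exists_normalized h0
  have hgM : |g| * (⟨p, q, 0⟩ : GridLine).height = 2 ^ n := by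
    rw [← hab, abs_mul, abs_mul, height, mul_max_of_nonneg _ _ (abs_nonneg g)]
  refine walkWithin_of_normalized hnorm (Dvd.intro_left _ hgM) ?_ hbox
  rw [← hgM, show g * q * (w.1 - u.1) - g * p * (w.2 - u.2)
    = g * (q * (w.1 - u.1) - p * (w.2 - u.2)) by ring, abs_mul] at hdir
  refine le_of_mul_le_mul_left ?_ (abs_pos.2 hg)
  linarith

/-! ### Splitting a displacement into two legs -/

theorem sqrt_add_sq_le (x y η : ℝ) :
    √(x ^ 2 + (y + η) ^ 2) ≤ √(x ^ 2 + y ^ 2) + |η| := by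
  have h0 : 0 ≤ x ^ 2 + y ^ 2 := by positivity
  apply Real.sqrt_le_iff.2
  refine ⟨by positivity, ?_⟩
  have h1 : |y| ≤ √(x ^ 2 + y ^ 2) := Real.abs_le_sqrt (by nlinarith [sq_nonneg x])
  have h2 := Real.sq_sqrt h0
  have h3 : y * η ≤ √(x ^ 2 + y ^ 2) * |η| := by
    calc y * η ≤ |y * η| := le_abs_self _
      _ = |y| * |η| := abs_mul _ _
      _ ≤ _ := mul_le_mul_of_nonneg_right h1 (abs_nonneg _)
  nlinarith [sq_abs η]

/-- The length of a path with two legs whose slopes differ by `δ`: the second-order term of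
`√(1 + m ^ 2)` is what matters. -/
theorem two_legs_length_le {x₁ x₂ m₁ δ : ℝ} (h₁ : 0 ≤ x₁) (h₂ : 0 ≤ x₂) (hX : 0 < x₁ + x₂) :
    √(x₁ ^ 2 + (m₁ * x₁) ^ 2) + √(x₂ ^ 2 + ((m₁ + δ) * x₂) ^ 2)
      ≤ √((x₁ + x₂) ^ 2 + (m₁ * x₁ + (m₁ + δ) * x₂) ^ 2) + (x₁ + x₂) * δ ^ 2 := by
  set X := x₁ + x₂ with hXdef
  set m := m₁ + δ * x₂ / X with hm
  have hmX : m * X = m₁ * x₁ + (m₁ + δ) * x₂ := by rw [hm]; field_simp; rw [hXdef]; ring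
  set S := √(1 + m ^ 2) with hS
  have hS2 : S ^ 2 = 1 + m ^ 2 := Real.sq_sqrt (by positivity)
  have hS1 : 1 ≤ S := Real.one_le_sqrt.2 (by nlinarith [sq_nonneg m])
  have leg : ∀ x t : ℝ, 0 ≤ x → √(x ^ 2 + (t * x) ^ 2) = x * √(1 + t ^ 2) := by
    intro x t hx
    rw [show x ^ 2 + (t * x) ^ 2 = x ^ 2 * (1 + t ^ 2) by ring, Real.sqrt_mul (sq_nonneg x),
      Real.sqrt_sq hx]
  have amgm : ∀ t : ℝ, √(1 + t ^ 2) * (2 * S) ≤ 2 + t ^ 2 + m ^ 2 := by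
    intro t
    have := Real.sq_sqrt (show 0 ≤ 1 + t ^ 2 by positivity)
    nlinarith [sq_nonneg (√(1 + t ^ 2) - S)]
  rw [leg _ _ h₁, leg _ _ h₂, ← hmX, leg _ _ hX.le, ← hS]
  have key : (x₁ * √(1 + m₁ ^ 2) + x₂ * √(1 + (m₁ + δ) ^ 2)) * (2 * S)
      ≤ (X * S + X * δ ^ 2) * (2 * S) := by
    have k1 := mul_le_mul_of_nonneg_left (amgm m₁) h₁
    have k2 := mul_le_mul_of_nonneg_left (amgm (m₁ + δ)) h₂
    have var : x₁ * m₁ ^ 2 + x₂ * (m₁ + δ) ^ 2 ≤ X * δ ^ 2 + X * m ^ 2 := by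
      have e : x₁ * m₁ ^ 2 + x₂ * (m₁ + δ) ^ 2
          = x₁ * (m₁ - m) ^ 2 + x₂ * (m₁ + δ - m) ^ 2 + X * m ^ 2 := by
        linear_combination (-2 * m) * hmX + (2 * m ^ 2 - m ^ 2) * hXdef
      have hfrac0 : 0 ≤ x₂ / X := by positivity
      have hfrac1 : x₂ / X ≤ 1 := (div_le_one hX).2 (by linarith)
      have d1 : (m₁ - m) ^ 2 ≤ δ ^ 2 := by
        rw [show m₁ - m = -(δ * (x₂ / X)) by rw [hm]; ring, neg_sq, mul_pow]
        exact mul_le_of_le_one_right (sq_nonneg δ) (pow_le_one₀ hfrac0 hfrac1)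
      have d2 : (m₁ + δ - m) ^ 2 ≤ δ ^ 2 := by
        rw [show m₁ + δ - m = δ * (1 - x₂ / X) by rw [hm]; ring, mul_pow]
        exact mul_le_of_le_one_right (sq_nonneg δ) (pow_le_one₀ (by linarith) (by linarith))
      rw [e, hXdef]
      nlinarith [mul_le_mul_of_nonneg_left d1 h₁, mul_le_mul_of_nonneg_left d2 h₂]
    have hδ : X * δ ^ 2 ≤ X * δ ^ 2 * (2 * S) :=
      le_mul_of_one_le_right (by positivity) (by linarith)
    nlinarith
  exact le_of_mul_le_mul_right key (by positivity)

/-- Splitting a displacement `(X, Y)` of slope in `[-1, 1]` into two nearly optimal legs with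
slopes `a / 2 ^ n` and `(a + 1) / 2 ^ n`. -/
theorem exists_two_legs (n : ℕ) {X Y : ℤ} (hX : 0 < X) (hY : |Y| ≤ X) :
    ∃ a x y : ℤ, |a| ≤ 2 ^ n ∧ |a + 1| ≤ 2 ^ n ∧ |x| ≤ X ∧ |X - x| ≤ X ∧ |y| ≤ X + 1 ∧
      |Y - y| ≤ X + 1 ∧ |a * x - 2 ^ n * y| ≤ 2 * 2 ^ n ∧
      |(a + 1) * (X - x) - 2 ^ n * (Y - y)| ≤ 2 * 2 ^ n ∧
      √((x : ℝ) ^ 2 + (y : ℝ) ^ 2) + √(((X - x : ℤ) : ℝ) ^ 2 + ((Y - y : ℤ) : ℝ) ^ 2)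
        ≤ √((X : ℝ) ^ 2 + (Y : ℝ) ^ 2) + X / 4 ^ n + 2 := by
  have hpow : (0 : ℤ) < 2 ^ n := by positivity
  rw [abs_le] at hY
  obtain ⟨a, ha1, ha2, ha3, ha4⟩ : ∃ a : ℤ, -2 ^ n ≤ a ∧ a + 1 ≤ 2 ^ n ∧ a * X ≤ 2 ^ n * Y ∧
      2 ^ n * Y ≤ (a + 1) * X := by
    rcases hY.2.eq_or_lt with h | h
    · exact ⟨2 ^ n - 1, by linarith, by linarith, by rw [h]; nlinarith, by rw [h]; linarith⟩
    · have h1 := Int.mul_ediv_add_emod (2 ^ n * Y) X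
      have h2 := Int.emod_nonneg (2 ^ n * Y) hX.ne'
      have h3 := Int.emod_lt_of_pos (2 ^ n * Y) hX
      refine ⟨2 ^ n * Y / X, ?_, ?_, by linarith, by linarith⟩
      · rw [Int.le_ediv_iff_mul_le hX]; nlinarith
      · exact (Int.ediv_lt_iff_lt_mul hX).2 (mul_lt_mul_of_pos_left h hpow)
  -- With this `x`, the second leg, of slope `(a + 1) / 2 ^ n`, ends exactly at `(X, Y)` if the
  -- first one has slope exactly `a / 2 ^ n`; rounding `y` disturbs this by less than one.
  set x := (a + 1) * X - 2 ^ n * Y with hx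
  have hx0 : 0 ≤ x := by linarith
  have hxX : x ≤ X := by linarith
  have h1 := Int.mul_ediv_add_emod (a * x) (2 ^ n)
  have h2 := Int.emod_nonneg (a * x) hpow.ne'
  have h3 := Int.emod_lt_of_pos (a * x) hpow
  set y := a * x / 2 ^ n with hy
  set ρ := a * x % 2 ^ n with hρ
  have hyeq : 2 ^ n * y = a * x - ρ := by linarith
  have hy2 : 2 ^ n * (Y - y) = (a + 1) * (X - x) + ρ := by
    have : 2 ^ n * Y = (a + 1) * X - x := by rw [hx]; ring
    rw [mul_sub, this, hyeq]; ring
  have ax1 : a * x ≤ 2 ^ n * x := mul_le_mul_of_nonneg_right (by linarith) hx0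
  have ax2 : -2 ^ n * x ≤ a * x := mul_le_mul_of_nonneg_right ha1 hx0
  have bx1 : (a + 1) * (X - x) ≤ 2 ^ n * (X - x) := mul_le_mul_of_nonneg_right ha2 (by linarith)
  have bx2 : -2 ^ n * (X - x) ≤ (a + 1) * (X - x) :=
    mul_le_mul_of_nonneg_right (by linarith) (by linarith)
  have xX : 2 ^ n * x ≤ 2 ^ n * X := mul_le_mul_of_nonneg_left hxX hpow.le
  have x0 : 0 ≤ 2 ^ n * x := by positivity
  refine ⟨a, x, y, ?_, ?_, ?_, ?_, ?_, ?_, ?_, ?_, ?_⟩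
  · rw [abs_le]; constructor <;> linarith
  · rw [abs_le]; constructor <;> linarith
  · rw [abs_le]; constructor <;> linarith
  · rw [abs_le]; constructor <;> linarith
  · rw [abs_le]; constructor <;> refine le_of_mul_le_mul_left ?_ hpow <;> linarith
  · rw [abs_le]; constructor <;> refine le_of_mul_le_mul_left ?_ hpow <;> linarith
  · rw [abs_le]; constructor <;> linarith
  · rw [abs_le]; constructor <;> linarith
  · have hpR : (0 : ℝ) < 2 ^ n := by positivity
    have hx0R : (0 : ℝ) ≤ x := by exact_mod_cast hx0
    have hx1R : (0 : ℝ) ≤ ((X - x : ℤ) : ℝ) := by exact_mod_cast sub_nonneg.2 hxX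
    have hXR : (0 : ℝ) < X := by exact_mod_cast hX
    have hsum : (x : ℝ) + ((X - x : ℤ) : ℝ) = X := by push_cast; ring
    have hyR : (y : ℝ) = (a : ℝ) / 2 ^ n * x + -((ρ : ℝ) / 2 ^ n) := by
      have : (2 : ℝ) ^ n * y = a * x - ρ := by exact_mod_cast hyeq
      field_simp
      linarith
    have hy2R : ((Y - y : ℤ) : ℝ)
        = ((a : ℝ) / 2 ^ n + 1 / 2 ^ n) * ((X - x : ℤ) : ℝ) + (ρ : ℝ) / 2 ^ n := by
      have : (2 : ℝ) ^ n * ((Y - y : ℤ) : ℝ) = (a + 1) * ((X - x : ℤ) : ℝ) + ρ := by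
        exact_mod_cast hy2
      field_simp
      linarith
    have hρR : |(ρ : ℝ) / 2 ^ n| ≤ 1 := by
      have e1 : (0 : ℝ) ≤ ρ := by exact_mod_cast h2
      have e2 : (ρ : ℝ) ≤ 2 ^ n := by exact_mod_cast h3.le
      rw [abs_of_nonneg (by positivity)]
      exact (div_le_one hpR).2 e2
    have hYR : (a : ℝ) / 2 ^ n * x + ((a : ℝ) / 2 ^ n + 1 / 2 ^ n) * ((X - x : ℤ) : ℝ) = Y := by
      have e : ((Y - y : ℤ) : ℝ) + y = Y := by push_cast; ring
      rw [hy2R, hyR] at e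
      linarith
    have l1 := sqrt_add_sq_le (x : ℝ) ((a : ℝ) / 2 ^ n * x) (-((ρ : ℝ) / 2 ^ n))
    have l2 := sqrt_add_sq_le ((X - x : ℤ) : ℝ)
      (((a : ℝ) / 2 ^ n + 1 / 2 ^ n) * ((X - x : ℤ) : ℝ)) ((ρ : ℝ) / 2 ^ n)
    have l3 := two_legs_length_le (m₁ := (a : ℝ) / 2 ^ n) (δ := 1 / 2 ^ n) hx0R hx1R
      (by rw [hsum]; exact hXR)
    rw [hsum, hYR] at l3
    rw [← hyR, abs_neg] at l1
    rw [← hy2R] at l2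
    have e4 : (X : ℝ) * (1 / 2 ^ n) ^ 2 = X / 4 ^ n := by
      rw [show (4 : ℝ) = 2 ^ 2 by norm_num, ← pow_mul, mul_comm 2 n, pow_mul]
      field_simp
    rw [e4] at l3
    linarith

/-- The exponents match: a displacement of up to `2 ^ (18 n + 18)`, divided by `4 ^ n`, is
`O(2 ^ (16 n))`. -/
theorem two_legs_total {n : ℕ} {d e X : ℝ} (hX : X ≤ 2 ^ (18 * n + 18))
    (h : e ≤ d + X / 4 ^ n + 2) :
    e + 2 * (2 ^ 47 * 2 ^ (16 * n)) ≤ d + 2 ^ 49 * 2 ^ (16 * n) := by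
  have h4 : X / 4 ^ n ≤ 2 ^ 18 * 2 ^ (16 * n) := by
    rw [div_le_iff₀ (by positivity), show (4 : ℝ) = 2 ^ 2 by norm_num, ← pow_mul, ← pow_add,
      ← pow_add]
    refine hX.trans (le_of_eq ?_)
    congr 1
    ring
  have h1 : (1 : ℝ) ≤ 2 ^ (16 * n) := one_le_pow₀ (by norm_num)
  norm_num at *
  linarith

theorem max_two_pow_abs {n : ℕ} {a : ℤ} (h : |a| ≤ 2 ^ n) : max |2 ^ n| |a| = 2 ^ n := by
  rw [abs_of_pos (by positivity), max_eq_left h]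

theorem walkWithin_shallow {n : ℕ} {u v : ℤ × ℤ} (hpos : 0 < v.1 - u.1)
    (hsl : |v.2 - u.2| ≤ v.1 - u.1) (hlt : v.1 - u.1 < 2 ^ (18 * n + 18)) :
    WalkWithin weight u v (‖toPlane u - toPlane v‖ + 2 ^ 49 * 2 ^ (16 * n)) := by
  have e19 : (2 : ℤ) ^ (18 * n + 19) = 2 * 2 ^ (18 * n + 18) := by ring
  have h18 : (1 : ℤ) ≤ 2 ^ (18 * n + 18) := one_le_pow₀ (by norm_num)
  obtain ⟨a, x, y, ha, hb, hx, hx', hy, hy', hd, hd', hlen⟩ := exists_two_legs n hpos hsl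
  have w1 := walkWithin_of_direction (a := 2 ^ n) (b := a) (u := u) (w := (u.1 + x, u.2 + y))
    (max_two_pow_abs ha) (by simpa only [add_sub_cancel_left] using hd)
    ⟨by simp only [add_sub_cancel_left]; linarith, by simp only [add_sub_cancel_left]; linarith⟩
  have w2 := walkWithin_of_direction (a := 2 ^ n) (b := a + 1) (u := (u.1 + x, u.2 + y)) (w := v)
    (max_two_pow_abs hb) (by simpa only [sub_sub] using hd')
    ⟨by simp only [← sub_sub]; linarith, by simp only [← sub_sub]; linarith⟩
  refine (w1.trans w2).mono ?_
  have hltR : ((v.1 - u.1 : ℤ) : ℝ) ≤ 2 ^ (18 * n + 18) := by exact_mod_cast hlt.le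
  have := two_legs_total hltR hlen
  rw [norm_sub_rev (toPlane u), norm_sub_rev _ (toPlane v), norm_sub_rev (toPlane u),
    toPlane_sub_norm, toPlane_sub_norm, toPlane_sub_norm]
  simp only [add_sub_cancel_left, ← sub_sub]
  linarith

theorem walkWithin_steep {n : ℕ} {u v : ℤ × ℤ} (hpos : 0 < v.2 - u.2)
    (hsl : |v.1 - u.1| ≤ v.2 - u.2) (hlt : v.2 - u.2 < 2 ^ (18 * n + 18)) :
    WalkWithin weight u v (‖toPlane u - toPlane v‖ + 2 ^ 49 * 2 ^ (16 * n)) := by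
  have e19 : (2 : ℤ) ^ (18 * n + 19) = 2 * 2 ^ (18 * n + 18) := by ring
  have h18 : (1 : ℤ) ≤ 2 ^ (18 * n + 18) := one_le_pow₀ (by norm_num)
  obtain ⟨a, x, y, ha, hb, hx, hx', hy, hy', hd, hd', hlen⟩ := exists_two_legs n hpos hsl
  have w1 := walkWithin_of_direction (a := a) (b := 2 ^ n) (u := u) (w := (u.1 + y, u.2 + x))
    (by rw [max_comm]; exact max_two_pow_abs ha)
    (by rw [abs_sub_comm]; simpa only [add_sub_cancel_left] using hd)
    ⟨by simp only [add_sub_cancel_left]; linarith, by simp only [add_sub_cancel_left]; linarith⟩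
  have w2 := walkWithin_of_direction (a := a + 1) (b := 2 ^ n) (u := (u.1 + y, u.2 + x)) (w := v)
    (by rw [max_comm]; exact max_two_pow_abs hb)
    (by rw [abs_sub_comm]; simpa only [sub_sub] using hd')
    ⟨by simp only [← sub_sub]; linarith, by simp only [← sub_sub]; linarith⟩
  refine (w1.trans w2).mono ?_
  have hltR : ((v.2 - u.2 : ℤ) : ℝ) ≤ 2 ^ (18 * n + 18) := by exact_mod_cast hlt.le
  have := two_legs_total hltR hlen
  rw [norm_sub_rev (toPlane u), norm_sub_rev _ (toPlane v), norm_sub_rev (toPlane u),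
    toPlane_sub_norm, toPlane_sub_norm, toPlane_sub_norm]
  simp only [add_sub_cancel_left, ← sub_sub]
  rw [add_comm (((y : ℤ) : ℝ) ^ 2), add_comm (((v.1 - u.1 - y : ℤ) : ℝ) ^ 2),
    add_comm (((v.1 - u.1 : ℤ) : ℝ) ^ 2)]
  linarith

theorem walkWithin_weight {n : ℕ} {u v : ℤ × ℤ} (huv : u ≠ v)
    (h : ‖toPlane u - toPlane v‖ < 2 ^ (18 * n + 18)) :
    WalkWithin weight u v (‖toPlane u - toPlane v‖ + 2 ^ 49 * 2 ^ (16 * n)) := by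
  have hle1 : ((|v.1 - u.1| : ℤ) : ℝ) ≤ ‖toPlane u - toPlane v‖ := by
    rw [norm_sub_rev, toPlane_sub_norm, Int.cast_abs]
    exact Real.abs_le_sqrt (by nlinarith [sq_nonneg ((v.2 - u.2 : ℤ) : ℝ)])
  have hle2 : ((|v.2 - u.2| : ℤ) : ℝ) ≤ ‖toPlane u - toPlane v‖ := by
    rw [norm_sub_rev, toPlane_sub_norm, Int.cast_abs]
    exact Real.abs_le_sqrt (by nlinarith [sq_nonneg ((v.1 - u.1 : ℤ) : ℝ)])
  have hlt1 : |v.1 - u.1| < 2 ^ (18 * n + 18) := by exact_mod_cast hle1.trans_lt h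
  have hlt2 : |v.2 - u.2| < 2 ^ (18 * n + 18) := by exact_mod_cast hle2.trans_lt h
  rcases le_total |v.2 - u.2| |v.1 - u.1| with hsl | hsl
  · rcases lt_trichotomy (v.1 - u.1) 0 with h0 | h0 | h0
    · rw [abs_of_neg h0, neg_sub] at hsl hlt1
      rw [abs_sub_comm] at hsl
      rw [norm_sub_rev]
      exact (walkWithin_shallow (by linarith) hsl hlt1).symm
    · rw [h0, abs_zero, abs_nonpos_iff] at hsl
      exact absurd (Prod.ext (by omega) (by omega)) huv
    · rw [abs_of_pos h0] at hsl hlt1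
      exact walkWithin_shallow h0 hsl hlt1
  · rcases lt_trichotomy (v.2 - u.2) 0 with h0 | h0 | h0
    · rw [abs_of_neg h0, neg_sub] at hsl hlt2
      rw [abs_sub_comm] at hsl
      rw [norm_sub_rev]
      exact (walkWithin_steep (by linarith) hsl hlt2).symm
    · rw [h0, abs_zero, abs_nonpos_iff] at hsl
      exact absurd (Prod.ext (by omega) (by omega)) huv
    · rw [abs_of_pos h0] at hsl hlt2
      exact walkWithin_steep h0 hsl hlt2

theorem theorem3 :
    ∃ W : Grid.edgeSet → ℝ≥0, ∃ C : ℝ, ∀ u v : ℤ × ℤ,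
      ‖toPlane u - toPlane v‖ - 1 ≤ gridDist W u v ∧
      gridDist W u v ≤
        ‖toPlane u - toPlane v‖ + C * ‖toPlane u - toPlane v‖ ^ ((8 : ℝ) / 9) := by
  refine ⟨weight, 2 ^ 49, fun u v => ⟨le_gridDist_weight u v, ?_⟩⟩
  rcases eq_or_ne u v with rfl | huv
  · refine (WalkWithin.refl u).gridDist_le.trans ?_
    simp only [sub_self, norm_zero]
    positivity
  have hd : 1 ≤ ‖toPlane u - toPlane v‖ := by
    rw [toPlane_sub_norm]
    apply Real.one_le_sqrt.2
    have : (1 : ℤ) ≤ (u.1 - v.1) ^ 2 + (u.2 - v.2) ^ 2 := by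
      by_contra! hcon
      have h1 : (u.1 - v.1) ^ 2 = 0 := by nlinarith [sq_nonneg (u.1 - v.1), sq_nonneg (u.2 - v.2)]
      have h2 : (u.2 - v.2) ^ 2 = 0 := by nlinarith [sq_nonneg (u.1 - v.1), sq_nonneg (u.2 - v.2)]
      exact huv (Prod.ext (sub_eq_zero.1 (pow_eq_zero_iff two_ne_zero |>.1 h1))
        (sub_eq_zero.1 (pow_eq_zero_iff two_ne_zero |>.1 h2)))
    exact_mod_cast this
  obtain ⟨n, hn1, hn2⟩ := exists_nat_pow_near hd (show (1 : ℝ) < 2 ^ 18 by norm_num)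
  rw [← pow_mul] at hn1 hn2
  refine (walkWithin_weight (n := n) huv hn2).gridDist_le.trans ?_
  gcongr
  calc (2 : ℝ) ^ (16 * n) = ((2 : ℝ) ^ (18 * n)) ^ ((8 : ℝ) / 9) := by
        rw [← Real.rpow_natCast, ← Real.rpow_natCast, ← Real.rpow_mul (by norm_num)]
        congr 1
        push_cast
        ring
    _ ≤ _ := Real.rpow_le_rpow (by positivity) hn1 (by norm_num)
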